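/- Let $v_0,\dots,v_{n-1}$ ($n\ge 3$) be the vertices of a convex polygon in the Euclidean plane, listed counterclockwise (indices modulo $n$, all vertices other than $v_j,v_{j+1}$ lying strictly to the left of the line directed from $v_j$ to $v_{j+1}$), let $e_j=\overline{v_jv_{j+1}}$ be its edges, and let the obstacle $O$ be the open convex region bounded by the polygon. A path is a continuous map from $[0,1]$ to the plane; its length is its arc length; it is legal if it avoids $O$; it is polygonal if it is piecewise affine with finitely many pieces. Let $p_s,p_\tau\in\mathbb{R}^2\setminus O$ be two points that do not see each other, i.e. $\overline{p_sp_\tau}\cap O\neq\emptyset$. For a point $p\notin O$, call a vertex $v\ne p$ with $\overline{pv}\cap O=\emptyset$ a left (right) tangent vertex from $p$ if $O$ lies to the left (right) of the line directed from $p$ to $v$; the furthest seen vertex from $p$ with $O$ on the left (right) is the left (right) tangent vertex at maximal distance from $p$. Then for each of $p=p_s,p_\tau$ and each side this vertex exists and is unique. Define two sets and two half planes as follows. * Counterclockwise: let $v_i$ be the furthest seen vertex from $p_s$ with $O$ on the left and $v_q$ the furthest seen vertex from $p_\tau$ with $O$ on the right, and put $B_{ccw}=\overline{p_sv_i}\cup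 e_i\cup e_{i+1}\cup\dots\cup e_{q-1}\cup\overline{v_qp_\tau}$ (indices modulo $n$, no edges if $i=q$). Let $H_{ccw}$ be the closed half plane to the right of the line directed from $p_s$ to $p_\tau$. * Clockwise: let $v_{i'}$ be the furthest seen vertex from $p_s$ with $O$ on the right and $v_{q'}$ the furthest seen vertex from $p_\tau$ with $O$ on the left, and put $B_{cw}=\overline{p_sv_{i'}}\cup e_{q'}\cup e_{q'+1}\cup\dots\cup e_{i'-1}\cup\overline{v_{q'}p_\tau}$ (indices modulo $n$, no edges if $i'=q'$). Let $H_{cw}$ be the closed half plane to the left of the line directed from $p_s$ to $p_\tau$. Let $|B_d|$ be the sum of the lengths of the listed segments and edges, for $d\in\{ccw,cw\}$. Then: 1. For each direction $d$, $B_d$ is the image of a legal polygonal path from $p_s$ to $p_\tau$ inside $H_d$ that has length $|B_d|$ and is shortest among all legal paths from $p_s$ to $p_\tau$ inside $H_d$; and every shortest legal path from $p_s$ to $p_\tau$ inside $H_d$ has image $B_d$. 2. A shortest legal polygonal path from $p_s$ to $p_\tau$ exists. Every such path has image $B_d$ and length $|B_d|$ for one of the two directions $d$, and it is shortest among all legal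 (not necessarily polygonal) paths from $p_s$ to $p_\tau$. -/

import Mathlib

open Set

namespace ConvexObstacle

/-- The Euclidean plane. -/
abbrev Plane : Type := EuclideanSpace ℝ (Fin 2)

/-- Twice the signed area of the triangle `a b c`: positive iff `c` lies strictly to the left of
the line directed from `a` to `b`, zero iff the three points are collinear. -/
def orient (a b c : Plane) : ℝ :=
  (b 0 - a 0) * (c 1 - a 1) - (b 1 - a 1) * (c 0 - a 0)

/-- `P` is a convex polygon with (genuine) vertices `P 0, …, P (n - 1)`, listed counterclockwise:
all the vertices other than the two endpoints of the edge from `P i` to `P (i + 1)` lie strictly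
to the left of that edge (indices modulo `n`). -/
def IsConvexPolygon {n : ℕ} [NeZero n] (P : Polygon Plane n) : Prop :=
  3 ≤ n ∧ ∀ i j : Fin n, j ≠ i → j ≠ i + 1 → 0 < orient (P i) (P (i + 1)) (P j)

/-- The obstacle: the open convex region bounded by the polygon. -/
def obstacle {n : ℕ} (P : Polygon Plane n) : Set Plane :=
  interior (convexHull ℝ (range P.vertices))

/-- The free space. -/
def freeSpace {n : ℕ} (P : Polygon Plane n) : Set Plane :=
  (obstacle P)ᶜ

/-- Two points see each other if the segment between them does not meet the obstacle. -/
def Visible {n : ℕ} (P : Polygon Plane n) (x y : Plane) : Prop :=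
  segment ℝ x y ∩ obstacle P = ∅

/-- The two directions of motion around the obstacle. -/
inductive Direction where
  | ccw : Direction
  | cw : Direction

/-- The opposite direction. -/
def Direction.reverse : Direction → Direction
  | .ccw => .cw
  | .cw => .ccw

/-- `1` for counterclockwise motion (obstacle on the left), `-1` for clockwise motion (obstacle on
the right). -/
def Direction.sign : Direction → ℝ
  | .ccw => 1
  | .cw => -1

/-- The `k`-th vertex is a tangent vertex from `p` for the direction `d`: it is a vertex other than
`p` seen from `p`, and the line through `p` and this vertex is a supporting line of the obstacle,
the obstacle lying to the left (`d = ccw`), resp. to the right (`d = cw`), of somebody moving from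
`p` to the vertex. -/
def IsTangentVertex {n : ℕ} (P : Polygon Plane n) (d : Direction) (p : Plane) (k : Fin n) : Prop :=
  P k ≠ p ∧ Visible P p (P k) ∧ ∀ x ∈ obstacle P, 0 ≤ d.sign * orient p (P k) x

/-- The `k`-th vertex is the furthest vertex seen from `p` in the direction `d`: the furthest of the
tangent vertices (there are two of these if the tangent ray contains an edge). -/
def IsFurthestSeenVertex {n : ℕ} (P : Polygon Plane n) (d : Direction) (p : Plane)
    (k : Fin n) : Prop :=
  IsTangentVertex P d p k ∧ ∀ j, IsTangentVertex P d p j → dist p (P j) ≤ dist p (P k)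

/-- The union of the edges `e_i, e_{i+1}, …, e_{q-1}` (indices modulo `n`), `e_j` being the edge
from `P j` to `P (j + 1)`; it is empty if `i = q`. -/
def edgeChain {n : ℕ} [NeZero n] (P : Polygon Plane n) (i q : Fin n) : Set Plane :=
  ⋃ j ∈ {j : Fin n | j - i < q - i}, segment ℝ (P j) (P (j + 1))

/-- The total length of the edges `e_i, e_{i+1}, …, e_{q-1}` (indices modulo `n`). -/
noncomputable def edgeChainLength {n : ℕ} [NeZero n] (P : Polygon Plane n) (i q : Fin n) : ℝ :=
  ∑ j : Fin n with j - i < q - i, dist (P j) (P (j + 1))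

/-- The edges met when moving along the boundary in the direction `d` from `P i` to `P q`. -/
def boundaryChain {n : ℕ} [NeZero n] (P : Polygon Plane n) : Direction → Fin n → Fin n → Set Plane
  | .ccw, i, q => edgeChain P i q
  | .cw, i, q => edgeChain P q i

/-- The length of the boundary chain. -/
noncomputable def boundaryChainLength {n : ℕ} [NeZero n] (P : Polygon Plane n) :
    Direction → Fin n → Fin n → ℝ
  | .ccw, i, q => edgeChainLength P i q
  | .cw, i, q => edgeChainLength P q i

/-- The set compiled of the segment from `s` to `P i`, the edges met when moving in the direction
`d` from `P i` to `P q`, and the segment from `P q` to `t`. -/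
def detour {n : ℕ} [NeZero n] (P : Polygon Plane n) (d : Direction) (s t : Plane)
    (i q : Fin n) : Set Plane :=
  segment ℝ s (P i) ∪ boundaryChain P d i q ∪ segment ℝ (P q) t

/-- The sum of the lengths of the segments of which the detour is compiled. -/
noncomputable def detourLength {n : ℕ} [NeZero n] (P : Polygon Plane n) (d : Direction)
    (s t : Plane) (i q : Fin n) : ℝ :=
  dist s (P i) + boundaryChainLength P d i q + dist (P q) t

/-- The closed half plane bounded by the line through `s` and `t` in which one passes from `s` to
`t` in the direction `d` around an obstacle between them: the one to the right of the line directed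
from `s` to `t` for `d = ccw`, the one to its left for `d = cw`. -/
def sideHalfPlane (d : Direction) (s t : Plane) : Set Plane :=
  {x | d.sign * orient s t x ≤ 0}

/-- Arc length of a path. -/
noncomputable def pathLength {a b : Plane} (γ : Path a b) : ENNReal :=
  eVariationOn γ univ

/-- Polygonal paths: piecewise affine with finitely many pieces. -/
def IsPolygonalPath {a b : Plane} (γ : Path a b) : Prop :=
  ∃ (m : ℕ) (τ : ℕ → unitInterval), Monotone τ ∧ τ 0 = 0 ∧ τ m = 1 ∧
    ∀ k < m, ∃ u w : Plane, ∀ x ∈ Icc (τ k) (τ (k + 1)), γ x = u + (x : ℝ) • w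

/-- Legal paths from `a` to `b`: those that do not pass through the obstacle. -/
def legalPaths {n : ℕ} (P : Polygon Plane n) (a b : Plane) : Set (Path a b) :=
  {γ | range γ ⊆ freeSpace P}

/-- Legal polygonal paths from `a` to `b`. -/
def legalPolygonalPaths {n : ℕ} (P : Polygon Plane n) (a b : Plane) : Set (Path a b) :=
  {γ | γ ∈ legalPaths P a b ∧ IsPolygonalPath γ}

/-- Legal paths from `a` to `b` that stay in the set `H`. -/
def legalPathsWithin {n : ℕ} (P : Polygon Plane n) (H : Set Plane) (a b : Plane) :
    Set (Path a b) :=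
  {γ | γ ∈ legalPaths P a b ∧ range γ ⊆ H}

/-- `γ` is a shortest path of the family `S`. -/
def IsShortestIn {a b : Plane} (S : Set (Path a b)) (γ : Path a b) : Prop :=
  γ ∈ S ∧ ∀ γ' ∈ S, pathLength γ ≤ pathLength γ'

end ConvexObstacle

open ConvexObstacle

/-!
Choose a point `o` of the obstacle strictly between `s` and `t`. A path from `s` to `t` passes `o`
on one of the two sides: between its first visit of the ray from `o` through `t` and its last visit
of the ray from `o` through `s` before that, it stays on one side of the line. So it crosses the
rays from `o` through the vertices of the detour on that side one after another and, the obstacle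
being convex and open, at points that are not nearer to `o` than the vertices. The length is at
least that of the chain of these crossing points.

The detour is a taut rope: it turns towards `o` at each of its vertices, since the tangent vertices
are the furthest ones. Hence the sum of the two unit vectors pointing from a vertex of the detour
to its neighbours has a negative inner product with the direction away from `o`: the first
variation of the length is positive when a vertex is moved outward along its ray. As the length of
a chain is a convex function of its vertices, each chain of crossing points is at least as long as
the detour, with equality only if the crossing points are the vertices; and then the pieces of the
path between consecutive vertices are as short as the segments, hence cover exactly these.
-/

namespace ConvexObstacle

lemma orient_rotate (a b c : Plane) : orient a b c = orient b c a := by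
  unfold orient; ring

lemma orient_swap (a b c : Plane) : orient b a c = -orient a b c := by
  unfold orient; ring

lemma orient_swap_right (a b c : Plane) : orient a c b = -orient a b c := by
  unfold orient; ring

@[simp] lemma orient_self_right (a b : Plane) : orient a b b = 0 := by
  unfold orient; ring

@[simp] lemma orient_self_outer (a b : Plane) : orient a b a = 0 := by
  unfold orient; ring

@[simp] lemma orient_self_left (a b : Plane) : orient a a b = 0 := by
  unfold orient; ring

lemma continuous_orient (a b : Plane) : Continuous (orient a b) := by
  unfold orient; fun_prop

lemma orient_lineMap (a b x y : Plane) (r : ℝ) :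
    orient a b (AffineMap.lineMap x y r) = (1 - r) * orient a b x + r * orient a b y := by
  simp only [orient, AffineMap.lineMap_apply, vsub_eq_sub, vadd_eq_add, PiLp.add_apply,
    PiLp.smul_apply, PiLp.sub_apply, smul_eq_mul]
  ring

lemma orient_lineMap_left (s t x : Plane) (r : ℝ) :
    orient (AffineMap.lineMap s t r) s x = -(r * orient s t x) := by
  simp only [orient, AffineMap.lineMap_apply, vsub_eq_sub, vadd_eq_add, PiLp.add_apply,
    PiLp.smul_apply, PiLp.sub_apply, smul_eq_mul]
  ring

lemma orient_lineMap_right (s t x : Plane) (r : ℝ) :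
    orient (AffineMap.lineMap s t r) t x = (1 - r) * orient s t x := by
  simp only [orient, AffineMap.lineMap_apply, vsub_eq_sub, vadd_eq_add, PiLp.add_apply,
    PiLp.smul_apply, PiLp.sub_apply, smul_eq_mul]
  ring

lemma convex_setOf_mul_orient_nonneg (ε : ℝ) (a b : Plane) :
    Convex ℝ {x | 0 ≤ ε * orient a b x} := by
  refine convex_iff_forall_pos.2 fun x hx y hy p q hp hq hpq => ?_
  obtain rfl : p = 1 - q := by linarith
  simp only [mem_ofPred_eq] at hx hy ⊢
  rw [← AffineMap.lineMap_apply_module, orient_lineMap]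
  nlinarith [mul_nonneg hp.le hx, mul_nonneg hq.le hy]

lemma ne_of_orient_pos {a b c : Plane} (h : 0 < orient a b c) : a ≠ b := by
  rintro rfl
  simp at h

lemma orient_pos_trans {o e a b c : Plane} (ha : 0 ≤ orient o e a) (hb : 0 < orient o e b)
    (hc : 0 < orient o e c) (hab : 0 < orient o a b) (hbc : 0 < orient o b c) :
    0 < orient o a c := by
  have plücker : orient o e b * orient o a c =
      orient o e a * orient o b c + orient o e c * orient o a b := by
    unfold orient; ring
  refine (pos_iff_pos_of_mul_pos ?_).1 hb
  rw [plücker]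
  positivity

lemma orient_neg_of_behind_chord {s t a b x : Plane} (ha : orient s t a < 0)
    (hb : orient s t b < 0) (hsab : 0 ≤ orient s a b) (habt : 0 ≤ orient a b t)
    (hsax : 0 ≤ orient s a x) (hbtx : 0 ≤ orient b t x) (habx : orient a b x < 0) :
    orient s t x < 0 := by
  by_contra! hx
  have from_left : orient a b x * -orient s t a =
      orient s a b * (-orient s t a + orient s t x) +
        orient s a x * (-orient s t b - -orient s t a) := by
    unfold orient; ring
  have from_right : orient a b x * -orient s t b =
      orient a b t * (-orient s t b + orient s t x) +
        orient b t x * (-orient s t a - -orient s t b) := by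
    unfold orient; ring
  rcases le_total (orient s t a) (orient s t b) with h | h
  · nlinarith [mul_nonneg habt (by linarith : 0 ≤ -orient s t b + orient s t x),
      mul_nonneg hbtx (sub_nonneg.2 (neg_le_neg h)), mul_neg_of_neg_of_pos habx (neg_pos.2 hb)]
  · nlinarith [mul_nonneg hsab (by linarith : 0 ≤ -orient s t a + orient s t x),
      mul_nonneg hsax (sub_nonneg.2 (neg_le_neg h)), mul_neg_of_neg_of_pos habx (neg_pos.2 ha)]

section FirstVariation

variable {E : Type*} [NormedAddCommGroup E] [InnerProductSpace ℝ E]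

lemma inner_normalize_le_norm (v x : E) : inner ℝ (NormedSpace.normalize v) x ≤ ‖x‖ := by
  refine (real_inner_le_norm _ _).trans (mul_le_of_le_one_left (norm_nonneg x) ?_)
  rcases eq_or_ne v 0 with rfl | hv
  · simp
  · exact (NormedSpace.norm_normalize hv).le

lemma inner_normalize_self (v : E) : inner ℝ (NormedSpace.normalize v) v = ‖v‖ := by
  rw [NormedSpace.normalize, real_inner_smul_left, real_inner_self_eq_norm_mul_norm,
    ← mul_assoc]
  exact inv_mul_mul_self ‖v‖

/-- The unit direction of the `k`-th edge of the chain `W 0, W 1, …`; it is `0` if this edge is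
degenerate. -/
noncomputable def edgeDirection (W : ℕ → E) (k : ℕ) : E :=
  NormedSpace.normalize (W (k + 1) - W k)

lemma dist_add_inner_sub_inner_le (W X : ℕ → E) (k : ℕ) :
    dist (W k) (W (k + 1)) + inner ℝ (edgeDirection W k) (X (k + 1) - W (k + 1)) -
        inner ℝ (edgeDirection W k) (X k - W k) ≤
      dist (X k) (X (k + 1)) := by
  calc
    _ = inner ℝ (edgeDirection W k) (X (k + 1) - X k) := by
      rw [dist_comm, dist_eq_norm, ← inner_normalize_self, ← edgeDirection, ← inner_add_right,
        ← inner_sub_right]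
      congr 1
      abel
    _ ≤ ‖X (k + 1) - X k‖ := inner_normalize_le_norm _ _
    _ = dist (X k) (X (k + 1)) := by rw [dist_comm, dist_eq_norm]

variable {W X : ℕ → E}

lemma sum_dist_add_sum_inner_le (h0 : X 0 = W 0) (m : ℕ) :
    ∑ k ∈ Finset.range (m + 1), dist (W k) (W (k + 1)) +
        ∑ k ∈ Finset.range m,
          inner ℝ (edgeDirection W k - edgeDirection W (k + 1)) (X (k + 1) - W (k + 1)) +
        inner ℝ (edgeDirection W m) (X (m + 1) - W (m + 1)) ≤
      ∑ k ∈ Finset.range (m + 1), dist (X k) (X (k + 1)) := by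
  induction m with
  | zero => simpa [h0] using dist_add_inner_sub_inner_le W X 0
  | succ m ih =>
    rw [Finset.sum_range_succ (fun k => dist (W k) _), Finset.sum_range_succ (fun k => inner ℝ _ _),
      Finset.sum_range_succ (fun k => dist (X k) _), inner_sub_left]
    linarith [dist_add_inner_sub_inner_le W X (m + 1)]

variable {m : ℕ} (h0 : X 0 = W 0) (hm : X (m + 1) = W (m + 1))
  (hX : ∀ k < m, X (k + 1) ≠ W (k + 1) →
    0 < inner ℝ (edgeDirection W k - edgeDirection W (k + 1)) (X (k + 1) - W (k + 1)))

include hX in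
lemma inner_edgeDirection_sub_nonneg {k : ℕ} (hk : k ∈ Finset.range m) :
    0 ≤ inner ℝ (edgeDirection W k - edgeDirection W (k + 1)) (X (k + 1) - W (k + 1)) := by
  rcases eq_or_ne (X (k + 1)) (W (k + 1)) with h | h
  · simp [h]
  · exact (hX k (Finset.mem_range.1 hk) h).le

include h0 hm hX

lemma sum_dist_le_sum_dist :
    ∑ k ∈ Finset.range (m + 1), dist (W k) (W (k + 1)) ≤
      ∑ k ∈ Finset.range (m + 1), dist (X k) (X (k + 1)) := by
  have hvar := sum_dist_add_sum_inner_le h0 m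
  rw [hm, sub_self, inner_zero_right] at hvar
  linarith [Finset.sum_nonneg fun k => inner_edgeDirection_sub_nonneg hX (k := k)]

lemma eq_of_sum_dist_le_sum_dist
    (hle : ∑ k ∈ Finset.range (m + 1), dist (X k) (X (k + 1)) ≤
      ∑ k ∈ Finset.range (m + 1), dist (W k) (W (k + 1))) {k : ℕ} (hk : k ≤ m + 1) :
    X k = W k := by
  have hvar := sum_dist_add_sum_inner_le h0 m
  rw [hm, sub_self, inner_zero_right] at hvar
  have hnonneg := fun k => inner_edgeDirection_sub_nonneg hX (k := k)
  have hzero := (Finset.sum_eq_zero_iff_of_nonneg hnonneg).1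
    (le_antisymm (by linarith) (Finset.sum_nonneg hnonneg))
  rcases k with _ | k
  · exact h0
  rcases (Nat.succ_le_succ_iff.1 hk).eq_or_lt with rfl | hkm
  · exact hm
  by_contra hne
  exact (hX k hkm hne).ne' (hzero k (Finset.mem_range.2 hkm))

end FirstVariation

/-- The planar cross product, that is, the determinant of the matrix with columns `v` and `w`. -/
def cross (v w : Plane) : ℝ :=
  v 0 * w 1 - v 1 * w 0

lemma orient_eq_cross_sub (a b c : Plane) : orient a b c = cross (b - a) (c - b) := by
  simp only [orient, cross, PiLp.sub_apply]
  ring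

lemma cross_smul_left (r : ℝ) (v w : Plane) : cross (r • v) w = r * cross v w := by
  simp only [cross, PiLp.smul_apply, smul_eq_mul]
  ring

lemma cross_smul_right (r : ℝ) (v w : Plane) : cross v (r • w) = r * cross v w := by
  simp only [cross, PiLp.smul_apply, smul_eq_mul]
  ring

lemma inner_eq (v w : Plane) : inner ℝ v w = v 0 * w 0 + v 1 * w 1 := by
  simp [PiLp.inner_apply, Fin.sum_univ_two, mul_comm]

lemma inner_sub_neg_of_cross_pos {u v w : Plane} (hu : ‖u‖ = 1) (hv : ‖v‖ = 1)
    (huv : 0 < cross u v) (huw : 0 < cross u w) (hvw : 0 < cross v w) :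
    inner ℝ (u - v) w < 0 := by
  have hu' : u 0 * u 0 + u 1 * u 1 = 1 := by
    rw [← inner_eq, real_inner_self_eq_norm_sq, hu, one_pow]
  have hv' : v 0 * v 0 + v 1 * v 1 = 1 := by
    rw [← inner_eq, real_inner_self_eq_norm_sq, hv, one_pow]
  have hlt : inner ℝ u v < 1 := by
    refine (inner_lt_one_iff_real_of_norm_eq_one hu hv).2 ?_
    rintro rfl
    simp [cross, mul_comm] at huv
  have bisector : cross u v * -inner ℝ (u - v) w =
      (1 - inner ℝ u v) * (cross v w + cross u w) := by
    simp only [cross, inner_eq, PiLp.sub_apply]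
    linear_combination (u 0 * w 1 - u 1 * w 0) * hv' + (v 0 * w 1 - v 1 * w 0) * hu'
  refine neg_pos.1 ((pos_iff_pos_of_mul_pos ?_).1 huv)
  rw [bisector]
  exact mul_pos (sub_pos.2 hlt) (add_pos hvw huw)

lemma inner_edgeDirection_sub_pos {W : ℕ → Plane} {o : Plane} {k : ℕ}
    (hk : 0 < orient (W k) (W (k + 1)) o) (hk' : 0 < orient (W (k + 1)) (W (k + 2)) o)
    (hturn : 0 < orient (W k) (W (k + 1)) (W (k + 2))) :
    0 < inner ℝ (edgeDirection W k - edgeDirection W (k + 1)) (W (k + 1) - o) := by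
  have hne : W (k + 1) - W k ≠ 0 := sub_ne_zero.2 (ne_of_orient_pos hk).symm
  have hne' : W (k + 2) - W (k + 1) ≠ 0 := sub_ne_zero.2 (ne_of_orient_pos hk').symm
  have hpos := inv_pos.2 (norm_pos_iff.2 hne)
  have hpos' := inv_pos.2 (norm_pos_iff.2 hne')
  have hneg := inner_sub_neg_of_cross_pos (u := edgeDirection W k) (v := edgeDirection W (k + 1))
    (w := o - W (k + 1)) (NormedSpace.norm_normalize hne) (NormedSpace.norm_normalize hne')
  simp only [edgeDirection, NormedSpace.normalize, cross_smul_left,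
    cross_smul_right] at hneg ⊢
  rw [← neg_sub o, inner_neg_right]
  refine neg_pos.2 (hneg ?_ ?_ ?_)
  · rw [← orient_eq_cross_sub]
    exact mul_pos hpos' (mul_pos hpos hturn)
  · rw [← orient_eq_cross_sub]
    exact mul_pos hpos hk
  · have : cross (W (k + 2) - W (k + 1)) (o - W (k + 1)) = orient (W (k + 1)) (W (k + 2)) o := by
      simp [orient, cross]
    rw [this]
    exact mul_pos hpos' hk'

section PathLength

variable {E : Type*} [PseudoEMetricSpace E] {a b c : E}

lemma eVariationOn_symm (γ : Path a b) : eVariationOn γ.symm univ = eVariationOn γ univ := by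
  have hanti : AntitoneOn unitInterval.symm univ := fun _ _ _ _ h =>
    unitInterval.symm_le_symm.2 h
  have := eVariationOn.comp_eq_of_antitoneOn γ unitInterval.symm hanti
  rwa [image_univ, unitInterval.symm_bijective.surjective.range_eq] at this

/-- The midpoint of two points of the unit interval. The maps `average · 0` and `average 1 ·`
parametrize the two halves of the interval on which a concatenation of two paths runs through its
two pieces. -/
noncomputable def average (x y : unitInterval) : unitInterval :=
  ⟨((x : ℝ) + y) / 2, by linarith [x.2.1, y.2.1], by linarith [x.2.2, y.2.2]⟩

@[simp] lemma coe_average (x y : unitInterval) : (average x y : ℝ) = ((x : ℝ) + y) / 2 := rfl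

lemma average_comm (x y : unitInterval) : average x y = average y x :=
  Subtype.ext (by rw [coe_average, coe_average, add_comm])

lemma average_self (x : unitInterval) : average x x = x :=
  Subtype.ext (by rw [coe_average, add_self_div_two])

lemma average_le_average {x x' y y' : unitInterval} (hx : x ≤ x') (hy : y ≤ y') :
    average x y ≤ average x' y' := by
  rw [← Subtype.coe_le_coe] at hx hy ⊢
  simp only [coe_average]
  linarith

lemma image_average_left (x y z : unitInterval) :
    (average · z) '' Icc x y = Icc (average x z) (average y z) := by
  refine Subset.antisymm (image_subset_iff.2 fun w hw => mem_Icc.2 ⟨average_le_average hw.1 le_rfl,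
    average_le_average hw.2 le_rfl⟩) fun w ⟨hxw, hwy⟩ => ?_
  rw [← Subtype.coe_le_coe, coe_average] at hxw hwy
  have hx : (x : ℝ) ≤ 2 * w - z := by linarith
  have hy : 2 * (w : ℝ) - z ≤ y := by linarith
  exact ⟨⟨2 * w - z, x.2.1.trans hx, hy.trans y.2.2⟩, ⟨hx, hy⟩, Subtype.ext (by simp)⟩

lemma image_average_right (x y z : unitInterval) :
    average z '' Icc x y = Icc (average z x) (average z y) := by
  simpa only [average_comm] using image_average_left x y z

lemma trans_average_zero (γ : Path a b) (γ' : Path b c) (x : unitInterval) :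
    γ.trans γ' (average x 0) = γ x := by
  rw [Path.trans_apply, dif_pos (by simpa using div_le_div_of_nonneg_right x.2.2 zero_le_two)]
  exact congrArg γ (Subtype.ext (by simp; ring))

lemma trans_average_one (γ : Path a b) (γ' : Path b c) (x : unitInterval) :
    γ.trans γ' (average 1 x) = γ' x := by
  rcases eq_or_ne x 0 with rfl | hx
  · rw [trans_average_zero, γ.target, γ'.source]
  · have hx : 0 < (x : ℝ) := x.2.1.lt_of_ne' (by simpa using hx)
    rw [Path.trans_apply, dif_neg (by simp; linarith)]
    exact congrArg γ' (Subtype.ext (by simp; ring))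

lemma eVariationOn_trans (γ : Path a b) (γ' : Path b c) :
    eVariationOn (γ.trans γ') univ = eVariationOn γ univ + eVariationOn γ' univ := by
  have first_half : eVariationOn (γ.trans γ') (Icc (average 0 0) (average 1 0)) =
      eVariationOn γ univ := by
    rw [← image_average_left, ← eVariationOn.comp_eq_of_monotoneOn _ _
      fun _ _ _ _ h => average_le_average h le_rfl, unitInterval.univ_eq_Icc]
    exact congrArg (eVariationOn · _) (funext (trans_average_zero γ γ'))
  have second_half : eVariationOn (γ.trans γ') (Icc (average 1 0) (average 1 1)) =
      eVariationOn γ' univ := by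
    rw [← image_average_right, ← eVariationOn.comp_eq_of_monotoneOn _ _
      fun _ _ _ _ h => average_le_average le_rfl h, unitInterval.univ_eq_Icc]
    exact congrArg (eVariationOn · _) (funext (trans_average_one γ γ'))
  rw [← first_half, ← second_half, unitInterval.univ_eq_Icc]
  nth_rewrite 1 [← average_self 0, ← average_self 1]
  simpa only [univ_inter] using (eVariationOn.Icc_add_Icc (γ.trans γ')
    (average_le_average zero_le_one le_rfl) (average_le_average le_rfl zero_le_one)
    (mem_univ (average 1 0))).symm

lemma sum_edist_le_eVariationOn_Icc {α : Type*} [LinearOrder α] (f : α → E) {τ : ℕ → α}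
    (hτ : Monotone τ) (N : ℕ) :
    ∑ k ∈ Finset.range N, edist (f (τ k)) (f (τ (k + 1))) ≤
      eVariationOn f (Icc (τ 0) (τ N)) := by
  simp only [edist_comm (f (τ _)) (f (τ (_ + 1)))]
  exact eVariationOn.sum_le_of_monotoneOn_Iic (hτ.monotoneOn _)
    fun k hk => ⟨hτ (Nat.zero_le k), hτ hk⟩

end PathLength

lemma eVariationOn_segment {E : Type*} [NormedAddCommGroup E] [NormedSpace ℝ E] (a b : E) :
    eVariationOn (Path.segment a b) univ = edist a b := by
  refine le_antisymm ?_ ?_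
  rotate_left
  · simpa using eVariationOn.edist_le (Path.segment a b) (mem_univ 0) (mem_univ 1)
  have hcoe : eVariationOn ((↑) : unitInterval → ℝ) univ ≤ 1 := by
    rw [unitInterval.univ_eq_Icc]
    have := ((Subtype.mono_coe (· ∈ unitInterval)).monotoneOn (Icc 0 1)).eVariationOn_eq
      (left_mem_Icc.2 zero_le_one) (right_mem_Icc.2 zero_le_one)
    simpa using this.le
  calc
    eVariationOn (Path.segment a b) univ
    _ ≤ nndist a b * eVariationOn ((↑) : unitInterval → ℝ) univ :=
      (lipschitzWith_lineMap a b).lipschitzOnWith.comp_eVariationOn_le (mapsTo_univ _ _)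
    _ ≤ nndist a b * 1 := by gcongr
    _ = edist a b := by rw [mul_one, edist_nndist]

section StrictConvex

variable {E : Type*} [NormedAddCommGroup E] [NormedSpace ℝ E] [StrictConvexSpace ℝ E]

lemma mem_segment_of_eVariationOn_le {α : Type*} [LinearOrder α] {f : α → E} {x y z : α}
    (hz : z ∈ Icc x y) (h : eVariationOn f (Icc x y) ≤ edist (f x) (f y)) :
    f z ∈ segment ℝ (f x) (f y) := by
  have hle : edist (f x) (f z) + edist (f z) (f y) ≤ edist (f x) (f y) := by
    refine le_trans ?_ h
    have := eVariationOn.Icc_add_Icc f hz.1 hz.2 (mem_univ z)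
    simp only [univ_inter] at this
    rw [← this]
    gcongr
    · exact eVariationOn.edist_le f (left_mem_Icc.2 hz.1) (right_mem_Icc.2 hz.1)
    · exact eVariationOn.edist_le f (left_mem_Icc.2 hz.2) (right_mem_Icc.2 hz.2)
  simp only [edist_dist] at hle
  rw [← ENNReal.ofReal_add dist_nonneg dist_nonneg,
    ENNReal.ofReal_le_ofReal_iff dist_nonneg] at hle
  exact mem_segment_iff_wbtw.2
    (dist_add_dist_eq_iff.1 (hle.antisymm (dist_triangle _ _ _)))

variable {α : Type*} [ConditionallyCompleteLinearOrder α] [TopologicalSpace α] [OrderTopology α]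
  [DenselyOrdered α] {f : α → E}

lemma image_Icc_eq_segment {x y : α} (hxy : x ≤ y) (hf : ContinuousOn f (Icc x y))
    (h : eVariationOn f (Icc x y) ≤ edist (f x) (f y)) :
    f '' Icc x y = segment ℝ (f x) (f y) := by
  refine Subset.antisymm (image_subset_iff.2 fun z hz => mem_segment_of_eVariationOn_le hz h) ?_
  rw [segment_eq_image_lineMap]
  rintro _ ⟨r, hr, rfl⟩
  obtain ⟨z, hz, hdist⟩ : ∃ z ∈ Icc x y, dist (f x) (f z) = r * dist (f x) (f y) := by
    refine intermediate_value_Icc hxy (by fun_prop : ContinuousOn (dist (f x) <| f ·) _) ?_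
    simp only [dist_self]
    exact ⟨mul_nonneg hr.1 dist_nonneg, mul_le_of_le_one_left dist_nonneg hr.2⟩
  refine ⟨z, hz, ?_⟩
  have hmem := mem_segment_of_eVariationOn_le hz h
  rw [segment_eq_image_lineMap] at hmem
  obtain ⟨r', hr', hz'⟩ := hmem
  rw [← hz'] at hdist ⊢
  rcases eq_or_ne (f x) (f y) with heq | hne
  · simp [heq]
  · rw [dist_left_lineMap, Real.norm_of_nonneg hr'.1] at hdist
    rw [mul_right_cancel₀ (dist_ne_zero.2 hne) hdist]

lemma image_Icc_eq_iUnion_segment {τ : ℕ → α} (hτ : Monotone τ) (hf : Continuous f) (N : ℕ)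
    (h : eVariationOn f (Icc (τ 0) (τ (N + 1))) ≤
      ∑ k ∈ Finset.range (N + 1), edist (f (τ k)) (f (τ (k + 1)))) :
    f '' Icc (τ 0) (τ (N + 1)) = ⋃ k < N + 1, segment ℝ (f (τ k)) (f (τ (k + 1))) := by
  induction N with
  | zero => simpa using image_Icc_eq_segment (hτ zero_le_one) hf.continuousOn (by simpa using h)
  | succ N ih =>
    have hsplit := eVariationOn.Icc_add_Icc f (hτ (Nat.zero_le (N + 1))) (hτ (N + 1).le_succ)
      (mem_univ _)
    simp only [univ_inter] at hsplit
    rw [← hsplit, Finset.sum_range_succ] at h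
    have hinit := sum_edist_le_eVariationOn_Icc f hτ (N + 1)
    have hlast : edist (f (τ (N + 1))) (f (τ (N + 2))) ≤
        eVariationOn f (Icc (τ (N + 1)) (τ (N + 2))) :=
      eVariationOn.edist_le f (left_mem_Icc.2 (hτ (N + 1).le_succ))
        (right_mem_Icc.2 (hτ (N + 1).le_succ))
    rw [← Icc_union_Icc_eq_Icc (hτ (Nat.zero_le (N + 1))) (hτ (N + 1).le_succ), image_union,
      biUnion_lt_succ]
    congr 1
    · exact ih (ENNReal.le_of_add_le_add_right (edist_ne_top _ _)
        ((add_le_add_right hlast _).trans h))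
    · refine image_Icc_eq_segment (hτ (N + 1).le_succ) hf.continuousOn
        (ENNReal.le_of_add_le_add_left ?_ ((add_le_add_left hinit _).trans h))
      exact (ENNReal.sum_lt_top.2 fun _ _ => edist_lt_top _ _).ne

end StrictConvex

lemma IsPolygonalPath.symm {a b : Plane} {γ : Path a b} (h : IsPolygonalPath γ) :
    IsPolygonalPath γ.symm := by
  obtain ⟨m, τ, hτ, h0, h1, hpiece⟩ := h
  refine ⟨m, fun k => unitInterval.symm (τ (m - k)), fun k l hkl =>
    unitInterval.symm_le_symm.2 (hτ (by lia)), by simp [h1], by simp [h0], fun k hk => ?_⟩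
  obtain ⟨u, w, huw⟩ := hpiece (m - (k + 1)) (by lia)
  rw [show m - (k + 1) + 1 = m - k by lia] at huw
  refine ⟨u + w, -w, fun x hx => ?_⟩
  have := huw (unitInterval.symm x)
    ⟨unitInterval.le_symm_comm.1 hx.2, unitInterval.symm_le_comm.1 hx.1⟩
  rw [Path.symm_apply, Function.comp_apply, this, unitInterval.coe_symm_eq]
  module

lemma isPolygonalPath_segment (a b : Plane) : IsPolygonalPath (Path.segment a b) := by
  refine ⟨1, fun k => if k = 0 then 0 else 1, monotone_nat_of_le_succ fun k => ?_, by simp,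
    by simp, fun k _ => ⟨a, b - a, fun x _ => ?_⟩⟩
  · simp only [Nat.succ_ne_zero, if_false]
    exact unitInterval.le_one'
  · simp [AffineMap.lineMap_apply, add_comm]

lemma IsPolygonalPath.trans {a b c : Plane} {γ : Path a b} {γ' : Path b c}
    (h : IsPolygonalPath γ) (h' : IsPolygonalPath γ') : IsPolygonalPath (γ.trans γ') := by
  obtain ⟨m, τ, hτ, h0, h1, hpiece⟩ := h
  obtain ⟨m', τ', hτ', h0', h1', hpiece'⟩ := h'
  have hstay : ∀ k, m ≤ k → τ k = 1 := fun k hk => le_antisymm unitInterval.le_one' (h1 ▸ hτ hk)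
  refine ⟨m + m', fun k => average (τ k) (τ' (k - m)), fun k l hkl =>
    average_le_average (hτ hkl) (hτ' (by lia)), ?_, ?_, fun k hk => ?_⟩
  · simp [h0, h0', average_self]
  · simp [hstay, h1', average_self]
  beta_reduce
  rcases lt_or_ge k m with hkm | hkm
  · obtain ⟨u, w, huw⟩ := hpiece k hkm
    refine ⟨u, (2 : ℝ) • w, ?_⟩
    rw [show k - m = 0 by lia, show k + 1 - m = 0 by lia, h0', ← image_average_left]
    rintro _ ⟨x, hx, rfl⟩
    simp only [trans_average_zero, huw x hx, coe_average, Icc.coe_zero]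
    module
  · obtain ⟨u, w, huw⟩ := hpiece' (k - m) (by lia)
    refine ⟨u - w, (2 : ℝ) • w, ?_⟩
    rw [hstay k hkm, hstay (k + 1) (by lia), show k + 1 - m = k - m + 1 by lia,
      ← image_average_right]
    rintro _ ⟨x, hx, rfl⟩
    simp only [trans_average_one, huw x hx, coe_average, Icc.coe_one]
    module

lemma exists_isPolygonalPath (W : ℕ → Plane) (N : ℕ) :
    ∃ β : Path (W 0) (W (N + 1)), IsPolygonalPath β ∧
      range β = ⋃ k < N + 1, segment ℝ (W k) (W (k + 1)) ∧
      pathLength β = ENNReal.ofReal (∑ k ∈ Finset.range (N + 1), dist (W k) (W (k + 1))) := by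
  simp only [ENNReal.ofReal_sum_of_nonneg fun _ _ => dist_nonneg, ← edist_dist]
  induction N with
  | zero =>
    refine ⟨Path.segment _ _, isPolygonalPath_segment _ _, ?_, ?_⟩
    · simp [Path.range_segment]
    · simpa [pathLength] using eVariationOn_segment (W 0) (W 1)
  | succ N ih =>
    obtain ⟨β, hβ, hrange, hlength⟩ := ih
    refine ⟨β.trans (Path.segment _ _), hβ.trans (isPolygonalPath_segment _ _), ?_, ?_⟩
    · rw [Path.trans_range, hrange, Path.range_segment, biUnion_lt_succ _ (N + 1)]
    · rw [pathLength, eVariationOn_trans, eVariationOn_segment, ← pathLength, hlength,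
        Finset.sum_range_succ _ (N + 1)]

lemma Direction.sign_ne_zero (d : Direction) : d.sign ≠ 0 := by
  cases d <;> simp [Direction.sign]

section SupportingLines

variable {U : Set Plane}

lemma exists_mul_orient_neg {ε : ℝ} (hε : ε ≠ 0) {a b : Plane} (hab : a ≠ b) :
    ∃ y, ε * orient a b y < 0 := by
  refine ⟨a + ε • !₂[b 1 - a 1, -(b 0 - a 0)], ?_⟩
  have horient : ε * orient a b (a + ε • !₂[b 1 - a 1, -(b 0 - a 0)]) =
      -(ε ^ 2 * inner ℝ (b - a) (b - a)) := by
    rw [inner_eq]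
    simp [orient]; ring
  have := real_inner_self_pos.2 (sub_ne_zero.2 hab.symm)
  rw [horient, neg_lt_zero]
  positivity

lemma mul_orient_pos_of_isOpen (hU : IsOpen U) {ε : ℝ} (hε : ε ≠ 0) {a b : Plane} (hab : a ≠ b)
    (h : ∀ x ∈ U, 0 ≤ ε * orient a b x) {x : Plane} (hx : x ∈ U) : 0 < ε * orient a b x := by
  refine (h x hx).lt_of_ne' fun h0 => ?_
  obtain ⟨y, hy⟩ := exists_mul_orient_neg hε hab
  have hcont : Continuous (AffineMap.lineMap x y : ℝ → Plane) := AffineMap.lineMap_continuous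
  have hnear : ∀ᶠ r in nhds (0 : ℝ), AffineMap.lineMap x y r ∈ U :=
    hcont.continuousAt.eventually_mem (hU.mem_nhds (by simpa using hx))
  obtain ⟨r, hr, hr0⟩ :=
    ((hnear.filter_mono nhdsWithin_le_nhds).and (self_mem_nhdsWithin (s := Ioi 0))).exists
  have := h _ hr
  rw [orient_lineMap, mul_add, mul_left_comm, h0] at this
  nlinarith [mul_neg_of_pos_of_neg (mem_Ioi.1 hr0) hy]

lemma segment_inter_eq_empty_of_orient_nonneg (hU : IsOpen U) {ε : ℝ} (hε : ε ≠ 0) {a b : Plane}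
    (hab : a ≠ b) (h : ∀ x ∈ U, 0 ≤ ε * orient a b x) : segment ℝ a b ∩ U = ∅ := by
  refine eq_empty_of_forall_notMem fun x ⟨hx, hxU⟩ => ?_
  rw [segment_eq_image_lineMap] at hx
  obtain ⟨r, -, rfl⟩ := hx
  simpa [orient_lineMap] using mul_orient_pos_of_isOpen hU hε hab h hxU

lemma exists_forall_orient_pos (hconv : Convex ℝ U) (hopen : IsOpen U) {p : Plane} (hp : p ∉ U) :
    ∃ e, ∀ x ∈ U, 0 < orient p e x := by
  obtain ⟨f, hf⟩ := geometric_hahn_banach_point_open hconv hopen hp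
  let w := (InnerProductSpace.toDual ℝ Plane).symm f
  refine ⟨!₂[p 0 + w 1, p 1 - w 0], fun x hx => ?_⟩
  have hlt := hf x hx
  rw [← InnerProductSpace.toDual_symm_apply (y := f),
    ← InnerProductSpace.toDual_symm_apply (y := f), inner_eq, inner_eq] at hlt
  simp only [orient, Matrix.cons_val_zero, Matrix.cons_val_one, w]
  linarith

lemma lineMap_mem_of_mem_closure {E : Type*} [AddCommGroup E] [Module ℝ E] [TopologicalSpace E]
    [IsTopologicalAddGroup E] [ContinuousConstSMul ℝ E] {s : Set E} (hconv : Convex ℝ s)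
    (hopen : IsOpen s) {x y : E} (hx : x ∈ s) (hy : y ∈ closure s) {c : ℝ} (h0 : 0 ≤ c)
    (h1 : c < 1) : AffineMap.lineMap x y c ∈ s := by
  rw [← hopen.interior_eq, AffineMap.lineMap_apply_module]
  exact hconv.combo_interior_closure_mem_interior (hopen.interior_eq.symm ▸ hx) hy
    (sub_pos.2 h1) h0 (sub_add_cancel 1 c)

end SupportingLines

section ExtremeDirection

variable {ι : Type*} [Finite ι]

lemma exists_forall_mul_le_mul {x y : ι → ℝ} (hy : ∀ j, 0 ≤ y j) (hpos : ∃ j, 0 < y j) :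
    ∃ k, (x k ≠ 0 ∨ y k ≠ 0) ∧ ∀ j, y k * x j ≤ x k * y j := by
  by_cases hray : ∃ k, y k = 0 ∧ 0 < x k
  · obtain ⟨k, hyk, hxk⟩ := hray
    refine ⟨k, .inl hxk.ne', fun j => ?_⟩
    rw [hyk, zero_mul]
    exact mul_nonneg hxk.le (hy j)
  · push Not at hray
    obtain ⟨k, hk, hmax⟩ := exists_max_image {j | 0 < y j} (fun j => x j / y j) (toFinite _) hpos
    refine ⟨k, .inr (ne_of_gt hk), fun j => ?_⟩
    rcases (hy j).eq_or_lt with hj | hj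
    · rw [← hj, mul_zero]
      exact mul_nonpos_of_nonneg_of_nonpos (le_of_lt hk) (hray j hj.symm)
    · have := hmax j hj
      rw [div_le_div_iff₀ hj hk] at this
      linarith

lemma exists_extreme_direction {p e : Plane} {v : ι → Plane} (ε : ℝ)
    (h : ∀ j, 0 ≤ orient p e (v j)) (hpos : ∃ j, 0 < orient p e (v j)) :
    ∃ k, v k ≠ p ∧ ∀ j, 0 ≤ ε * orient p (v k) (v j) := by
  obtain ⟨k, hk, hmax⟩ :=
    exists_forall_mul_le_mul (x := fun j => ε * inner ℝ (e - p) (v j - p)) h hpos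
  refine ⟨k, ?_, fun j => ?_⟩
  · rintro hkp
    simp [hkp] at hk
  obtain ⟨i, hi⟩ := hpos
  have hnorm := real_inner_self_pos.2 (sub_ne_zero.2 (ne_of_orient_pos hi).symm)
  have lagrange : inner ℝ (e - p) (e - p) * (ε * orient p (v k) (v j)) =
      ε * inner ℝ (e - p) (v k - p) * orient p e (v j) -
        orient p e (v k) * (ε * inner ℝ (e - p) (v j - p)) := by
    simp only [inner_eq, orient, PiLp.sub_apply]
    ring
  refine nonneg_of_mul_nonneg_right (?_ : 0 ≤ inner ℝ (e - p) (e - p) * _) hnorm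
  exact lagrange ▸ sub_nonneg.2 (hmax j)

end ExtremeDirection

lemma orient_eq_mul_of_sub_eq_smul {p a b : Plane} {r : ℝ} (h : b - p = r • (a - p)) (x : Plane) :
    orient p b x = r * orient p a x := by
  obtain rfl : b = AffineMap.lineMap p a r := by
    rw [AffineMap.lineMap_apply, vsub_eq_sub, ← h, vadd_eq_add, sub_add_cancel]
  simp only [orient, AffineMap.lineMap_apply, vsub_eq_sub, vadd_eq_add, PiLp.add_apply,
    PiLp.smul_apply, PiLp.sub_apply, smul_eq_mul]
  ring

lemma sameRay_of_orient_eq_zero {ε : ℝ} {p a b x : Plane} (h : orient p a b = 0)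
    (ha : 0 < ε * orient p a x) (hb : 0 < ε * orient p b x) : SameRay ℝ (a - p) (b - p) := by
  refine .inr (.inr ⟨_, _, hb, ha, ?_⟩)
  unfold orient at *
  ext i
  fin_cases i
  · simp only [PiLp.smul_apply, PiLp.sub_apply, smul_eq_mul, Fin.zero_eta]
    linear_combination ε * (p 0 - x 0) * h
  · simp only [PiLp.smul_apply, PiLp.sub_apply, smul_eq_mul, Fin.mk_one]
    linear_combination ε * (p 1 - x 1) * h

section Obstacle

variable {n : ℕ} {P : Polygon Plane n}

lemma isOpen_obstacle : IsOpen (obstacle P) := isOpen_interior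

lemma convex_obstacle : Convex ℝ (obstacle P) := (convex_convexHull ℝ _).interior

lemma vertex_mem_closure_obstacle (hO : (obstacle P).Nonempty) (j : Fin n) :
    P j ∈ closure (obstacle P) := by
  rw [obstacle, (convex_convexHull ℝ _).closure_interior_eq_closure_of_nonempty_interior hO]
  exact subset_closure (subset_convexHull ℝ _ (mem_range_self j))

lemma mul_orient_nonneg_of_forall_vertex {ε : ℝ} {a b : Plane}
    (h : ∀ j, 0 ≤ ε * orient a b (P j)) : ∀ x ∈ obstacle P, 0 ≤ ε * orient a b x := by
  intro x hx
  refine convexHull_min ?_ (convex_setOf_mul_orient_nonneg ε a b) (interior_subset hx)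
  rintro _ ⟨j, rfl⟩
  exact h j

lemma mul_orient_vertex_nonneg (hO : (obstacle P).Nonempty) {ε : ℝ} {a b : Plane}
    (h : ∀ x ∈ obstacle P, 0 ≤ ε * orient a b x) (j : Fin n) : 0 ≤ ε * orient a b (P j) := by
  have hclosed : IsClosed {x | 0 ≤ ε * orient a b x} :=
    isClosed_le continuous_const (continuous_const.mul (continuous_orient a b))
  exact closure_minimal h hclosed (vertex_mem_closure_obstacle hO j)

variable {d : Direction} {p o : Plane} {j k : Fin n}

lemma isTangentVertex_of_forall_orient_nonneg (hkp : P k ≠ p)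
    (h : ∀ x ∈ obstacle P, 0 ≤ d.sign * orient p (P k) x) : IsTangentVertex P d p k :=
  ⟨hkp, segment_inter_eq_empty_of_orient_nonneg isOpen_obstacle d.sign_ne_zero hkp.symm h, h⟩

lemma exists_isTangentVertex (hO : (obstacle P).Nonempty) (hp : p ∈ freeSpace P)
    (d : Direction) : ∃ k, IsTangentVertex P d p k := by
  obtain ⟨e, he⟩ := exists_forall_orient_pos convex_obstacle isOpen_obstacle hp
  have hnonneg (j) : 0 ≤ orient p e (P j) := by
    simpa using mul_orient_vertex_nonneg (ε := 1) hO (fun x hx => by simpa using (he x hx).le) j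
  have hpos : ∃ j, 0 < orient p e (P j) := by
    by_contra! hall
    obtain ⟨o, ho⟩ := hO
    linarith [he o ho, mul_orient_nonneg_of_forall_vertex (ε := -1)
      (fun j => by linarith [hall j]) o ho]
  obtain ⟨k, hkp, hk⟩ := exists_extreme_direction d.sign hnonneg hpos
  exact ⟨k, isTangentVertex_of_forall_orient_nonneg hkp (mul_orient_nonneg_of_forall_vertex hk)⟩

lemma exists_isFurthestSeenVertex (hO : (obstacle P).Nonempty) (hp : p ∈ freeSpace P)
    (d : Direction) : ∃ k, IsFurthestSeenVertex P d p k := by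
  obtain ⟨k, hk, hmax⟩ := exists_max_image {k | IsTangentVertex P d p k} (fun k => dist p (P k))
    (toFinite _) (exists_isTangentVertex hO hp d)
  exact ⟨k, hk, hmax⟩

lemma IsTangentVertex.orient_pos (hk : IsTangentVertex P d p k) (ho : o ∈ obstacle P) :
    0 < d.sign * orient p (P k) o :=
  mul_orient_pos_of_isOpen isOpen_obstacle d.sign_ne_zero hk.1.symm hk.2.2 ho

lemma IsTangentVertex.orient_eq_zero (hO : (obstacle P).Nonempty) (hj : IsTangentVertex P d p j)
    (hk : IsTangentVertex P d p k) : orient p (P j) (P k) = 0 := by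
  have hjk := mul_orient_vertex_nonneg hO hj.2.2 k
  have hkj := mul_orient_vertex_nonneg hO hk.2.2 j
  rw [orient_swap_right] at hkj
  exact (mul_eq_zero.1 (le_antisymm (by linarith) hjk)).resolve_left d.sign_ne_zero

lemma IsFurthestSeenVertex.point_eq (hO : (obstacle P).Nonempty)
    (hj : IsFurthestSeenVertex P d p j) (hk : IsFurthestSeenVertex P d p k) : P j = P k := by
  have hdist := le_antisymm (hk.2 j hj.1) (hj.2 k hk.1)
  obtain ⟨o, ho⟩ := hO
  have hray := sameRay_of_orient_eq_zero (hj.1.orient_eq_zero ⟨o, ho⟩ hk.1)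
    (hj.1.orient_pos ho) (hk.1.orient_pos ho)
  rw [dist_comm, dist_comm p, dist_eq_norm, dist_eq_norm] at hdist
  exact sub_left_injective ((sameRay_iff_of_norm_eq hdist).1 hray)

/-- The obstacle boundary turns strictly away from the tangent line at the furthest seen vertex:
a further vertex on that line would be a tangent vertex as well. -/
lemma IsFurthestSeenVertex.orient_pos (hO : (obstacle P).Nonempty)
    (hk : IsFurthestSeenVertex P d p k) (ho : o ∈ obstacle P)
    (hj : 0 < d.sign * orient (P k) (P j) o) : 0 < d.sign * orient p (P k) (P j) := by
  refine (mul_orient_vertex_nonneg hO hk.1.2.2 j).lt_of_ne' fun hzero => ?_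
  have hcollinear := (mul_eq_zero.1 hzero).resolve_left d.sign_ne_zero
  have hsplit : orient (P k) (P j) o =
      orient p (P j) o - orient p (P k) o + orient p (P k) (P j) := by
    unfold orient; ring
  rw [hsplit, hcollinear, add_zero, mul_sub, sub_pos] at hj
  have hkpos := hk.1.orient_pos ho
  obtain ⟨r, hr, hjr⟩ := (sameRay_of_orient_eq_zero hcollinear hkpos
    (hkpos.trans hj)).exists_nonneg_left (sub_ne_zero.2 hk.1.1)
  have hone : 1 < r := by
    rw [orient_eq_mul_of_sub_eq_smul hjr.symm, mul_left_comm] at hj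
    exact (lt_mul_iff_one_lt_left hkpos).1 hj
  have hjp : P j ≠ p := by
    rintro h
    simp [h, (zero_lt_one.trans hone).ne', sub_eq_zero, hk.1.1] at hjr
  have hle := hk.2 j <| isTangentVertex_of_forall_orient_nonneg hjp fun x hx => by
    rw [orient_eq_mul_of_sub_eq_smul hjr.symm, mul_left_comm]
    exact mul_nonneg hr (hk.1.2.2 x hx)
  rw [dist_comm, dist_eq_norm, ← hjr, norm_smul, Real.norm_of_nonneg hr, dist_comm,
    dist_eq_norm] at hle
  nlinarith [norm_pos_iff.2 (sub_ne_zero.2 hk.1.1)]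

end Obstacle

section Polygon

variable {n : ℕ} [NeZero n]

lemma add_ofNat_succ (i : Fin n) (k : ℕ) : i + Fin.ofNat n (k + 1) = i + Fin.ofNat n k + 1 := by
  rw [add_assoc]
  congr 1
  ext
  simp [Fin.val_add]

lemma add_ofNat_val_sub (i j : Fin n) : i + Fin.ofNat n (j - i).val = j := by
  simp

lemma add_ofNat_ne (i : Fin n) {k l : ℕ} (hkl : k < l) (hln : l < k + n) :
    i + Fin.ofNat n k ≠ i + Fin.ofNat n l := by
  intro h
  have hmod : k ≡ l [MOD n] := congrArg Fin.val (add_left_cancel h)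
  have := Nat.le_of_dvd (by omega) ((Nat.modEq_iff_dvd' hkl.le).1 hmod)
  omega

lemma sub_lt_sub_iff_exists (i q j : Fin n) :
    j - i < q - i ↔ ∃ k < (q - i).val, i + Fin.ofNat n k = j := by
  constructor
  · exact fun h => ⟨(j - i).val, h, add_ofNat_val_sub i j⟩
  · rintro ⟨k, hk, rfl⟩
    rw [add_sub_cancel_left, Fin.lt_def]
    simpa [Nat.mod_eq_of_lt (hk.trans (q - i).isLt)] using hk

/-- The vertex reached from `P i` by moving `k` steps counterclockwise. The index runs through the
natural numbers, so that cyclic order statements become inequalities. -/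
def vertexFrom (P : Polygon Plane n) (i : Fin n) (k : ℕ) : Plane :=
  P (i + Fin.ofNat n k)

lemma vertexFrom_zero (P : Polygon Plane n) (i : Fin n) : vertexFrom P i 0 = P i := by
  simp [vertexFrom]

lemma vertexFrom_succ (P : Polygon Plane n) (i : Fin n) (k : ℕ) :
    vertexFrom P i (k + 1) = P (i + Fin.ofNat n k + 1) := by
  rw [vertexFrom, add_ofNat_succ]

lemma vertexFrom_add_period (P : Polygon Plane n) (i : Fin n) (k : ℕ) :
    vertexFrom P i (k + n) = vertexFrom P i k := by
  have : Fin.ofNat n (k + n) = Fin.ofNat n k := by ext; simp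
  rw [vertexFrom, vertexFrom, this]

lemma vertexFrom_val_sub (P : Polygon Plane n) (i q : Fin n) :
    vertexFrom P i (q - i).val = P q := by
  rw [vertexFrom, add_ofNat_val_sub]

variable {P : Polygon Plane n}

lemma IsConvexPolygon.orient_vertexFrom_succ_pos (hP : IsConvexPolygon P) (i : Fin n) {k l : ℕ}
    (hkl : k + 1 < l) (hln : l < k + n) :
    0 < orient (vertexFrom P i k) (vertexFrom P i (k + 1)) (vertexFrom P i l) := by
  rw [vertexFrom_succ]
  refine hP.2 _ _ (add_ofNat_ne i (by omega) hln).symm ?_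
  rw [← add_ofNat_succ]
  exact (add_ofNat_ne i hkl (by omega)).symm

/-- The two steps of the induction are edges: that from `k` to `k + 1` serves as the axis along
which the other vertices are compared. -/
lemma IsConvexPolygon.orient_vertexFrom_pos (hP : IsConvexPolygon P) (i : Fin n) {k l m : ℕ}
    (hkl : k < l) (hlm : l < m) (hmn : m < k + n) :
    0 < orient (vertexFrom P i k) (vertexFrom P i l) (vertexFrom P i m) := by
  have consecutive {l : ℕ} (hkl : k < l) (hln : l + 1 < k + n) :
      0 < orient (vertexFrom P i k) (vertexFrom P i l) (vertexFrom P i (l + 1)) := by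
    rw [orient_rotate, ← vertexFrom_add_period P i k]
    exact hP.orient_vertexFrom_succ_pos i hln (by omega)
  induction m, hlm using Nat.le_induction with
  | base => exact consecutive hkl hmn
  | succ m hlm ih =>
    have axis {j : ℕ} (hj : k + 1 < j) (hjn : j < k + n) := hP.orient_vertexFrom_succ_pos i hj hjn
    refine orient_pos_trans ?_ (axis (by omega) (by omega)) (axis (by omega) hmn)
      (ih (by omega)) (consecutive (by omega) hmn)
    rcases Nat.eq_or_lt_of_le hkl with rfl | hkl
    · simp
    · exact (axis hkl (by omega)).le

lemma IsConvexPolygon.vertex_ne_succ (hP : IsConvexPolygon P) (i : Fin n) : P i ≠ P (i + 1) := by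
  have := hP.orient_vertexFrom_succ_pos i (k := 0) (l := 2) (by omega) (by have := hP.1; omega)
  simpa [vertexFrom_zero, vertexFrom_succ] using ne_of_orient_pos this

lemma IsConvexPolygon.injective (hP : IsConvexPolygon P) : Function.Injective P.vertices := by
  intro i j hij
  by_contra hne
  have := hP.2 i j (Ne.symm hne) fun h => hP.vertex_ne_succ i (h ▸ hij)
  rw [← show P i = P j from hij] at this
  simp at this

lemma IsConvexPolygon.existsUnique_isFurthestSeenVertex (hP : IsConvexPolygon P)
    (hO : (obstacle P).Nonempty) {p : Plane} (hp : p ∈ freeSpace P) (d : Direction) :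
    ∃! k, IsFurthestSeenVertex P d p k := by
  obtain ⟨k, hk⟩ := exists_isFurthestSeenVertex hO hp d
  exact ⟨k, hk, fun j hj => hP.injective (hj.point_eq hO hk)⟩

lemma IsConvexPolygon.isTangentVertex_succ (hP : IsConvexPolygon P) (i : Fin n) :
    IsTangentVertex P .ccw (P i) (i + 1) := by
  refine isTangentVertex_of_forall_orient_nonneg (hP.vertex_ne_succ i).symm
    (mul_orient_nonneg_of_forall_vertex fun j => ?_)
  rw [Direction.sign, one_mul]
  by_cases hi : j = i
  · simp [hi]
  by_cases hi' : j = i + 1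
  · simp [hi']
  exact (hP.2 i j hi hi').le

lemma IsConvexPolygon.orient_edge_pos (hP : IsConvexPolygon P) (i : Fin n) {x : Plane}
    (hx : x ∈ obstacle P) : 0 < orient (P i) (P (i + 1)) x := by
  simpa [Direction.sign] using (hP.isTangentVertex_succ i).orient_pos hx

lemma IsConvexPolygon.edgeChain_subset_freeSpace (hP : IsConvexPolygon P) (i q : Fin n) :
    edgeChain P i q ⊆ freeSpace P :=
  iUnion₂_subset fun j _ => disjoint_iff_inter_eq_empty.2 (hP.isTangentVertex_succ j).2.1
    |>.subset_compl_right

lemma IsConvexPolygon.detour_subset_freeSpace (hP : IsConvexPolygon P) (d : Direction)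
    {s t : Plane} {i q : Fin n} (hi : Visible P s (P i)) (hq : Visible P t (P q)) :
    detour P d s t i q ⊆ freeSpace P := by
  refine union_subset (union_subset ?_ ?_) ?_
  · exact (disjoint_iff_inter_eq_empty.2 hi).subset_compl_right
  · cases d <;> exact hP.edgeChain_subset_freeSpace _ _
  · rw [segment_symm]
    exact (disjoint_iff_inter_eq_empty.2 hq).subset_compl_right

lemma edgeChain_eq_iUnion_vertexFrom (P : Polygon Plane n) (i q : Fin n) :
    edgeChain P i q =
      ⋃ k < (q - i).val, segment ℝ (vertexFrom P i k) (vertexFrom P i (k + 1)) := by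
  ext x
  simp only [edgeChain, mem_iUnion, exists_prop, mem_ofPred_eq, sub_lt_sub_iff_exists,
    vertexFrom_succ]
  constructor
  · rintro ⟨_, ⟨k, hk, rfl⟩, hx⟩
    exact ⟨k, hk, hx⟩
  · rintro ⟨k, hk, hx⟩
    exact ⟨_, ⟨k, hk, rfl⟩, hx⟩

lemma edgeChainLength_eq_sum_vertexFrom (P : Polygon Plane n) (i q : Fin n) :
    edgeChainLength P i q =
      ∑ k ∈ Finset.range (q - i).val, dist (vertexFrom P i k) (vertexFrom P i (k + 1)) := by
  have himage : Finset.univ.filter (fun j : Fin n => j - i < q - i) =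
      (Finset.range (q - i).val).image fun k => i + Fin.ofNat n k := by
    ext j
    simp [sub_lt_sub_iff_exists, -Fin.ofNat_eq_cast]
  rw [edgeChainLength, himage, Finset.sum_image]
  · simp only [vertexFrom, add_ofNat_succ]
  · intro k hk l hl h
    have hlt := (q - i).isLt
    simp only [Finset.coe_range, mem_Iio] at hk hl
    rcases lt_trichotomy k l with hkl | hkl | hkl
    · exact absurd h (add_ofNat_ne i hkl (by omega))
    · exact hkl
    · exact absurd h.symm (add_ofNat_ne i hkl (by omega))

/-- The points met in turn by the counterclockwise detour: `s`, the vertices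
`P i, P (i + 1), …, P (i + m)`, and `t`. -/
def detourPoint (P : Polygon Plane n) (s t : Plane) (i : Fin n) (m : ℕ) : ℕ → Plane
  | 0 => s
  | k + 1 => if k ≤ m then vertexFrom P i k else t

variable {s t : Plane} {i : Fin n} {k m : ℕ}

lemma detourPoint_succ (hk : k ≤ m) : detourPoint P s t i m (k + 1) = vertexFrom P i k :=
  if_pos hk

lemma detourPoint_last : detourPoint P s t i m (m + 2) = t :=
  if_neg (Nat.not_succ_le_self m)

lemma detour_ccw_eq_iUnion (P : Polygon Plane n) (s t : Plane) (i q : Fin n) :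
    detour P .ccw s t i q = ⋃ k < (q - i).val + 2, segment ℝ
      (detourPoint P s t i (q - i).val k) (detourPoint P s t i (q - i).val (k + 1)) := by
  rw [biUnion_lt_succ, biUnion_lt_succ', detour, boundaryChain, edgeChain_eq_iUnion_vertexFrom,
    detourPoint_succ le_rfl, detourPoint_last, detourPoint_succ (Nat.zero_le _),
    vertexFrom_val_sub, vertexFrom_zero]
  congr 2
  exact iUnion₂_congr fun k hk => by
    rw [detourPoint_succ hk.le, detourPoint_succ (Nat.succ_le_of_lt hk)]

lemma detourLength_ccw_eq_sum (P : Polygon Plane n) (s t : Plane) (i q : Fin n) :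
    detourLength P .ccw s t i q = ∑ k ∈ Finset.range ((q - i).val + 2), dist
      (detourPoint P s t i (q - i).val k) (detourPoint P s t i (q - i).val (k + 1)) := by
  rw [Finset.sum_range_succ, Finset.sum_range_succ', detourLength, boundaryChainLength,
    edgeChainLength_eq_sum_vertexFrom, detourPoint_succ le_rfl, detourPoint_last,
    detourPoint_succ (Nat.zero_le _), vertexFrom_val_sub, vertexFrom_zero, add_comm (dist s _)]
  congr 2
  refine Finset.sum_congr rfl fun k hk => ?_
  have hk := Finset.mem_range.1 hk
  rw [detourPoint_succ hk.le, detourPoint_succ (Nat.succ_le_of_lt hk)]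

end Polygon

section Rays

lemma eq_lineMap_of_orient_eq_zero {s t o w x : Plane} (ho : orient s t o = 0)
    (hw : orient s t w ≠ 0) (hx : orient o w x = 0) :
    x = AffineMap.lineMap o w (orient s t x / orient s t w) := by
  unfold orient at *
  ext i
  fin_cases i
  · simp only [AffineMap.lineMap_apply, vsub_eq_sub, vadd_eq_add, PiLp.add_apply,
      PiLp.smul_apply, PiLp.sub_apply, smul_eq_mul, Fin.zero_eta]
    field_simp
    linear_combination (x 0 - w 0) * ho - (t 0 - s 0) * hx
  · simp only [AffineMap.lineMap_apply, vsub_eq_sub, vadd_eq_add, PiLp.add_apply,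
      PiLp.smul_apply, PiLp.sub_apply, smul_eq_mul, Fin.mk_one]
    field_simp
    linear_combination (x 1 - w 1) * ho - (t 1 - s 1) * hx

lemma exists_eq_lineMap_of_orient_eq_zero {a b x : Plane} (hab : a ≠ b) (h : orient a b x = 0) :
    ∃ r : ℝ, x = AffineMap.lineMap a b r := by
  obtain ⟨y, hy⟩ := exists_mul_orient_neg one_ne_zero hab
  refine ⟨_, eq_lineMap_of_orient_eq_zero (s := a) (t := y) (orient_self_outer a y) ?_ h⟩
  rw [orient_swap_right]
  intro h0
  linarith

lemma sameRay_or_sameRay_of_orient_eq_zero {s t o x : Plane} (ho : o ∈ segment ℝ s t)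
    (hx : orient s t x = 0) : SameRay ℝ (s - o) (x - o) ∨ SameRay ℝ (t - o) (x - o) := by
  rw [segment_eq_image_lineMap] at ho
  obtain ⟨r, ⟨hr0, hr1⟩, rfl⟩ := ho
  rcases eq_or_ne s t with rfl | hst
  · simp
  obtain ⟨c, rfl⟩ := exists_eq_lineMap_of_orient_eq_zero hst hx
  have hsub (a : ℝ) : AffineMap.lineMap s t a - AffineMap.lineMap s t r = (a - r) • (t - s) := by
    simp only [AffineMap.lineMap_apply, vsub_eq_sub, vadd_eq_add]
    module
  have hs := hsub 0
  have ht := hsub 1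
  rw [AffineMap.lineMap_apply_zero] at hs
  rw [AffineMap.lineMap_apply_one] at ht
  rw [hs, ht, hsub]
  rcases le_total c r with hcr | hcr
  · left
    rw [← sameRay_neg_iff, ← neg_smul, ← neg_smul]
    exact ((SameRay.refl _).nonneg_smul_left (by linarith)).nonneg_smul_right (by linarith)
  · right
    exact ((SameRay.refl _).nonneg_smul_left (by linarith)).nonneg_smul_right (by linarith)

lemma isClosed_setOf_sameRay_sub {E : Type*} [NormedAddCommGroup E] [NormedSpace ℝ E]
    (v o : E) : IsClosed {x | SameRay ℝ v (x - o)} := by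
  simp only [sameRay_iff_norm_smul_eq]
  exact isClosed_eq (by fun_prop) (by fun_prop)

end Rays

section Passing

lemma exists_sides_of_ne_zero_on_Ioo {α β : unitInterval} {g : unitInterval → ℝ} (hg : Continuous g)
    (h : ∀ u ∈ Ioo α β, g u ≠ 0) :
    (∀ u ∈ Icc α β, g u ≤ 0) ∨ ∀ u ∈ Icc α β, 0 ≤ g u := by
  by_contra! hsigns
  obtain ⟨⟨x, hx, hx0⟩, y, hy, hy0⟩ := hsigns
  rcases le_total x y with hxy | hyx
  · obtain ⟨z, hz, hz0⟩ := intermediate_value_Ioo' hxy hg.continuousOn ⟨hy0, hx0⟩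
    exact h z (Ioo_subset_Ioo hx.1 hy.2 hz) hz0
  · obtain ⟨z, hz, hz0⟩ := intermediate_value_Ioo hyx hg.continuousOn ⟨hy0, hx0⟩
    exact h z (Ioo_subset_Ioo hy.1 hx.2 hz) hz0

lemma exists_last_exit_first_entry {E : Type*} [TopologicalSpace E] {a b : E} (γ : Path a b)
    {S T : Set E} (hS : IsClosed S) (hT : IsClosed T) (ha : a ∈ S) (hb : b ∈ T) :
    ∃ α β, α ≤ β ∧ γ α ∈ S ∧ γ β ∈ T ∧ ∀ u ∈ Ioo α β, γ u ∉ S ∧ γ u ∉ T := by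
  obtain ⟨β, hβT, hβ⟩ := (hT.preimage γ.continuous).isCompact.exists_isLeast
    ⟨1, by simpa using hb⟩
  obtain ⟨α, ⟨hαS, hαβ⟩, hα⟩ := ((hS.preimage γ.continuous).inter
    isClosed_Iic).isCompact.exists_isGreatest ⟨0, by simpa using ha, β.2.1⟩
  exact ⟨α, β, hαβ, hαS, hβT, fun u hu =>
    ⟨fun hS => (hα ⟨hS, hu.2.le⟩).not_gt hu.1, fun hT => (hβ hT).not_gt hu.2⟩⟩

/-- `γ` has a piece on the side `d` of the line through `s` and `t` that starts on the ray from `o`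
through `s` and ends on the ray from `o` through `t`. -/
def PassesOn (d : Direction) (o : Plane) {s t : Plane} (γ : Path s t) : Prop :=
  ∃ α β : unitInterval, α ≤ β ∧ SameRay ℝ (s - o) (γ α - o) ∧ SameRay ℝ (t - o) (γ β - o) ∧
    ∀ u ∈ Icc α β, γ u ∈ sideHalfPlane d s t

variable {d : Direction} {s t o : Plane} {γ : Path s t}

lemma passesOn_of_range_subset (h : range γ ⊆ sideHalfPlane d s t) (o : Plane) :
    PassesOn d o γ :=
  ⟨0, 1, zero_le_one, by simp [SameRay.refl], by simp [SameRay.refl],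
    fun u _ => h (mem_range_self u)⟩

lemma exists_passesOn (ho : o ∈ segment ℝ s t) (γ : Path s t) : ∃ d, PassesOn d o γ := by
  obtain ⟨α, β, hαβ, hα, hβ, hbetween⟩ := exists_last_exit_first_entry γ
    (isClosed_setOf_sameRay_sub (s - o) o) (isClosed_setOf_sameRay_sub (t - o) o)
    (SameRay.refl _) (SameRay.refl _)
  have hoff : ∀ u ∈ Ioo α β, orient s t (γ u) ≠ 0 := fun u hu h0 =>
    (sameRay_or_sameRay_of_orient_eq_zero ho h0).elim (hbetween u hu).1 (hbetween u hu).2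
  rcases exists_sides_of_ne_zero_on_Ioo ((continuous_orient s t).comp γ.continuous) hoff
    with hright | hleft
  · exact ⟨.ccw, α, β, hαβ, hα, hβ, fun u hu => by
      simpa [sideHalfPlane, Direction.sign] using hright u hu⟩
  · exact ⟨.cw, α, β, hαβ, hα, hβ, fun u hu => by
      simpa [sideHalfPlane, Direction.sign] using hleft u hu⟩

lemma sideHalfPlane_reverse (d : Direction) (s t : Plane) :
    sideHalfPlane d.reverse t s = sideHalfPlane d s t := by
  ext x
  simp only [sideHalfPlane, mem_ofPred_eq, orient_swap s t]
  cases d <;> simp [Direction.reverse, Direction.sign]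

lemma PassesOn.symm (h : PassesOn d o γ) : PassesOn d.reverse o γ.symm := by
  obtain ⟨α, β, hαβ, hα, hβ, hside⟩ := h
  refine ⟨unitInterval.symm β, unitInterval.symm α, unitInterval.symm_le_symm.2 hαβ,
    by simpa using hβ, by simpa using hα, fun u hu => ?_⟩
  rw [sideHalfPlane_reverse]
  exact hside (unitInterval.symm u)
    ⟨unitInterval.le_symm_comm.1 hu.2, unitInterval.symm_le_comm.1 hu.1⟩

end Passing

section TautChain

lemma ofReal_sum_dist_le_pathLength {a b : Plane} (γ : Path a b) {τ : ℕ → unitInterval}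
    (hτ : Monotone τ) (N : ℕ) :
    ENNReal.ofReal (∑ k ∈ Finset.range N, dist (γ (τ k)) (γ (τ (k + 1)))) ≤ pathLength γ := by
  rw [ENNReal.ofReal_sum_of_nonneg fun _ _ => dist_nonneg]
  simp only [← edist_dist]
  exact (sum_edist_le_eVariationOn_Icc γ hτ N).trans (eVariationOn.mono γ (subset_univ _))

lemma exists_monotone_forall_lt {α : Type*} [Preorder α] [OrderTop α] {m : ℕ}
    {good : ℕ → α → Prop} {x a : α} (hxa : x ≤ a) (ha : good 0 a)
    (step : ∀ k < m, ∀ u, good k u → ∃ v, u ≤ v ∧ good (k + 1) v) :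
    ∃ τ : ℕ → α, Monotone τ ∧ τ 0 = x ∧ τ (m + 1) = ⊤ ∧ ∀ k < m, good (k + 1) (τ (k + 1)) := by
  induction m generalizing good x a with
  | zero =>
    refine ⟨fun k => k.casesOn x fun _ => ⊤, monotone_nat_of_le_succ fun k => ?_, rfl, rfl, by simp⟩
    exact le_top
  | succ m ih =>
    obtain ⟨v, hav, hv⟩ := step 0 m.succ_pos a ha
    obtain ⟨τ, hτ, hτ0, hτm, hgood⟩ := ih (good := fun k => good (k + 1)) le_rfl hv
      fun k hk => step (k + 1) (Nat.succ_lt_succ hk)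
    refine ⟨fun k => k.casesOn x τ, monotone_nat_of_le_succ fun k => ?_, rfl, hτm, fun k hk => ?_⟩
    · cases k with
      | zero => exact (hxa.trans hav).trans_eq hτ0.symm
      | succ k => exact hτ k.le_succ
    · cases k with
      | zero => exact (congrArg _ hτ0).mpr hv
      | succ k => exact hgood k (Nat.lt_of_succ_lt_succ hk)

/-- A chain of left turns `s = W 0, …, W (m + 1) = t` around a point `o` between `s` and `t`, to the
right of the line from `s` to `t`, such that `O` contains the segments from `o` to the inner points
of the chain, except for these points themselves. It is the shape of a rope pulled taut around
`O`. -/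
structure IsTautChain (O : Set Plane) (o s t : Plane) (W : ℕ → Plane) (m : ℕ) : Prop where
  mem_openSegment : o ∈ openSegment ℝ s t
  start : W 0 = s
  finish : W (m + 1) = t
  left : ∀ k ≤ m, 0 < orient (W k) (W (k + 1)) o
  turn : ∀ k < m, 0 < orient (W k) (W (k + 1)) (W (k + 2))
  side : ∀ k < m, orient s t (W (k + 1)) < 0
  star : ∀ k < m, ∀ c : ℝ, 0 ≤ c → c < 1 → AffineMap.lineMap o (W (k + 1)) c ∈ O

lemma exists_sameRay_of_sides {s t o w : Plane} {f : unitInterval → Plane} (hf : Continuous f)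
    {u v : unitInterval} (huv : u ≤ v) (ho : orient s t o = 0) (hw : orient s t w < 0)
    (hu : orient o w (f u) ≤ 0) (hv : 0 ≤ orient o w (f v))
    (hside : ∀ x ∈ Icc u v, orient s t (f x) ≤ 0) :
    ∃ x ∈ Icc u v, SameRay ℝ (w - o) (f x - o) := by
  obtain ⟨x, hx, hx0⟩ := intermediate_value_Icc huv
    ((continuous_orient o w).comp hf).continuousOn ⟨hu, hv⟩
  refine ⟨x, hx, ?_⟩
  rw [eq_lineMap_of_orient_eq_zero ho hw.ne hx0, AffineMap.lineMap_apply, vsub_eq_sub,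
    vadd_eq_add, add_sub_cancel_right]
  exact SameRay.sameRay_nonneg_smul_right _ (div_nonneg_of_nonpos (hside x hx) hw.le)

namespace IsTautChain

variable {O : Set Plane} {o s t : Plane} {W : ℕ → Plane} {m : ℕ} (hW : IsTautChain O o s t W m)

include hW

lemma orient_eq_zero : orient s t o = 0 := by
  have ho := hW.mem_openSegment
  rw [openSegment_eq_image_lineMap] at ho
  obtain ⟨r, -, rfl⟩ := ho
  simp [orient_lineMap]

lemma orient_finish_pos {k : ℕ} (hk : k < m) : 0 < orient o (W (k + 1)) t := by
  have hside := hW.side k hk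
  have ho := hW.mem_openSegment
  rw [openSegment_eq_image_lineMap] at ho
  obtain ⟨r, hr, rfl⟩ := ho
  rw [orient_swap_right, orient_lineMap_right]
  nlinarith [hr.2]

variable {γ : Path s t}

lemma exists_next_crossing {k : ℕ} (hk : k < m) {u β : unitInterval} (huβ : u ≤ β)
    (hu : SameRay ℝ (W k - o) (γ u - o)) (hβ : SameRay ℝ (t - o) (γ β - o))
    (hside : ∀ x ∈ Icc u β, orient s t (γ x) ≤ 0) :
    ∃ v ∈ Icc u β, SameRay ℝ (W (k + 1) - o) (γ v - o) := by
  have hleft := hW.left k hk.le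
  have hright := hW.orient_finish_pos hk
  have hbefore : orient o (W (k + 1)) (γ u) ≤ 0 := by
    have hne : W k ≠ o := by
      intro h
      simp [h] at hleft
    obtain ⟨c, hc, hcu⟩ := hu.exists_nonneg_left (sub_ne_zero.2 hne)
    rw [orient_swap_right, orient_eq_mul_of_sub_eq_smul hcu.symm, orient_rotate]
    exact neg_nonpos.2 (mul_nonneg hc hleft.le)
  have hafter : 0 ≤ orient o (W (k + 1)) (γ β) := by
    have hne : t ≠ o := by
      intro h
      simp [h] at hright
    obtain ⟨c, hc, hcβ⟩ := hβ.exists_nonneg_left (sub_ne_zero.2 hne)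
    rw [orient_swap_right, orient_eq_mul_of_sub_eq_smul hcβ.symm, orient_swap_right, mul_neg,
      neg_neg]
    exact mul_nonneg hc hright.le
  exact exists_sameRay_of_sides γ.continuous huβ hW.orient_eq_zero (hW.side k hk) hbefore hafter
    hside

lemma exists_crossings (hpass : PassesOn .ccw o γ) :
    ∃ τ : ℕ → unitInterval, Monotone τ ∧ τ 0 = 0 ∧ τ (m + 1) = 1 ∧
      ∀ k < m, SameRay ℝ (W (k + 1) - o) (γ (τ (k + 1)) - o) := by
  obtain ⟨α, β, hαβ, hα, hβ, hside⟩ := hpass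
  simp only [sideHalfPlane, Direction.sign, one_mul, mem_ofPred_eq] at hside
  have hnext : ∀ k < m, ∀ u, u ∈ Icc α β ∧ SameRay ℝ (W k - o) (γ u - o) →
      ∃ v, u ≤ v ∧ v ∈ Icc α β ∧ SameRay ℝ (W (k + 1) - o) (γ v - o) := by
    rintro k hk u ⟨hu, hray⟩
    obtain ⟨v, hv, hray⟩ := hW.exists_next_crossing hk hu.2 hray hβ
      fun x hx => hside x ⟨hu.1.trans hx.1, hx.2⟩
    exact ⟨v, hv.1, ⟨hu.1.trans hv.1, hv.2⟩, hray⟩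
  obtain ⟨τ, hτ, hτ0, hτm, hgood⟩ := exists_monotone_forall_lt unitInterval.nonneg'
    ⟨left_mem_Icc.2 hαβ, hW.start ▸ hα⟩ hnext
  exact ⟨τ, hτ, hτ0, hτm, fun k hk => (hgood k hk).2⟩

lemma exists_smul_sub_of_sameRay {k : ℕ} (hk : k < m) {x : Plane} (hx : x ∉ O)
    (hray : SameRay ℝ (W (k + 1) - o) (x - o)) :
    ∃ c : ℝ, 0 ≤ c ∧ x - W (k + 1) = c • (W (k + 1) - o) := by
  have hne : W (k + 1) ≠ o := by
    intro h
    have := hW.side k hk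
    rw [h, hW.orient_eq_zero] at this
    exact this.false
  obtain ⟨c, hc, hcx⟩ := hray.exists_nonneg_left (sub_ne_zero.2 hne)
  refine ⟨c - 1, sub_nonneg.2 (not_lt.1 fun hc1 => hx ?_), ?_⟩
  · have := hW.star k hk c hc hc1
    rwa [AffineMap.lineMap_apply, vsub_eq_sub, vadd_eq_add, hcx, sub_add_cancel] at this
  · rw [sub_smul, hcx, one_smul, sub_sub_sub_cancel_right]

/-- Moving an inner point of the chain away from `o` increases the length to first order, since the
chain turns left there. -/
lemma inner_edgeDirection_sub_pos {k : ℕ} (hk : k < m) {x : Plane} (hx : x ∉ O)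
    (hray : SameRay ℝ (W (k + 1) - o) (x - o)) (hne : x ≠ W (k + 1)) :
    0 < inner ℝ (edgeDirection W k - edgeDirection W (k + 1)) (x - W (k + 1)) := by
  obtain ⟨c, hc, hcx⟩ := hW.exists_smul_sub_of_sameRay hk hx hray
  have hcpos : 0 < c := hc.lt_of_ne' fun h => hne (sub_eq_zero.1 (by rw [hcx, h, zero_smul]))
  rw [hcx, real_inner_smul_right]
  exact mul_pos hcpos (ConvexObstacle.inner_edgeDirection_sub_pos (hW.left k hk.le)
    (hW.left (k + 1) hk) (hW.turn k hk))

lemma le_pathLength (hγ : ∀ u, γ u ∉ O) (hpass : PassesOn .ccw o γ) :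
    ENNReal.ofReal (∑ k ∈ Finset.range (m + 1), dist (W k) (W (k + 1))) ≤ pathLength γ := by
  obtain ⟨τ, hτ, hτ0, hτm, hray⟩ := hW.exists_crossings hpass
  have hsum := sum_dist_le_sum_dist (X := γ ∘ τ) (W := W) (by simp [hτ0, hW.start])
    (by simp [hτm, hW.finish])
    fun k hk => hW.inner_edgeDirection_sub_pos hk (hγ (τ (k + 1))) (hray k hk)
  exact (ENNReal.ofReal_le_ofReal hsum).trans (ofReal_sum_dist_le_pathLength γ hτ (m + 1))

lemma range_eq_of_pathLength_le (hγ : ∀ u, γ u ∉ O) (hpass : PassesOn .ccw o γ)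
    (hle : pathLength γ ≤
      ENNReal.ofReal (∑ k ∈ Finset.range (m + 1), dist (W k) (W (k + 1)))) :
    range γ = ⋃ k < m + 1, segment ℝ (W k) (W (k + 1)) := by
  obtain ⟨τ, hτ, hτ0, hτm, hray⟩ := hW.exists_crossings hpass
  have hvertex : ∀ k ≤ m + 1, γ (τ k) = W k := fun k hk =>
    eq_of_sum_dist_le_sum_dist (X := γ ∘ τ) (W := W) (by simp [hτ0, hW.start])
      (by simp [hτm, hW.finish])
      (fun k hk => hW.inner_edgeDirection_sub_pos hk (hγ (τ (k + 1))) (hray k hk))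
      ((ENNReal.ofReal_le_ofReal_iff (Finset.sum_nonneg fun _ _ => dist_nonneg)).1
        ((ofReal_sum_dist_le_pathLength γ hτ (m + 1)).trans hle)) hk
  have himage := image_Icc_eq_iUnion_segment hτ γ.continuous m
  rw [hτ0, hτm, ← unitInterval.univ_eq_Icc, image_univ] at himage
  rw [himage]
  · exact iUnion₂_congr fun k hk => by rw [hvertex k hk.le, hvertex (k + 1) hk]
  · rw [ENNReal.ofReal_sum_of_nonneg fun _ _ => dist_nonneg] at hle
    refine hle.trans_eq (Finset.sum_congr rfl fun k hk => ?_)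
    have hk := Finset.mem_range.1 hk
    rw [← edist_dist, hvertex k hk.le, hvertex (k + 1) hk]

end IsTautChain

end TautChain

section DetourChain

variable {n : ℕ} {P : Polygon Plane n} {d : Direction} {s t p p' o : Plane}

lemma exists_mem_openSegment_obstacle (hs : s ∈ freeSpace P) (ht : t ∈ freeSpace P)
    (hst : ¬ Visible P s t) : ∃ o ∈ openSegment ℝ s t, o ∈ obstacle P := by
  obtain ⟨o, hseg, ho⟩ := nonempty_iff_ne_empty.2 hst
  exact ⟨o, mem_openSegment_of_ne_left_right (fun h => hs (h ▸ ho)) (fun h => ht (h ▸ ho)) hseg, ho⟩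

lemma IsTangentVertex.orient_chord_neg {k : Fin n} (hk : IsTangentVertex P d p k)
    (hseg : o ∈ openSegment ℝ p p') (ho : o ∈ obstacle P) : d.sign * orient p p' (P k) < 0 := by
  have hpos := hk.orient_pos ho
  rw [openSegment_eq_image_lineMap] at hseg
  obtain ⟨r, hr, rfl⟩ := hseg
  rw [← orient_rotate, orient_lineMap_left] at hpos
  exact neg_of_mul_neg_right (by linarith) hr.1.le

variable [NeZero n] {i : Fin n} {m : ℕ}

lemma orient_vertexFrom_neg (hP : IsConvexPolygon P) (hseg : o ∈ openSegment ℝ s t)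
    (ho : o ∈ obstacle P) (hi : IsTangentVertex P .ccw s i)
    (hq : IsTangentVertex P .cw t (i + Fin.ofNat n m)) (hmn : m < n) {k : ℕ} (hk : k ≤ m) :
    orient s t (vertexFrom P i k) < 0 := by
  have hO : (obstacle P).Nonempty := ⟨o, ho⟩
  have hfirst : orient s t (P i) < 0 := by
    simpa [Direction.sign] using hi.orient_chord_neg hseg ho
  have hlast : orient s t (vertexFrom P i m) < 0 := by
    rw [orient_swap]
    simpa [Direction.sign, vertexFrom] using hq.orient_chord_neg (openSegment_symm ℝ s t ▸ hseg) ho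
  have hleft (j) : 0 ≤ orient s (P i) (P j) := by
    simpa [Direction.sign] using mul_orient_vertex_nonneg hO hi.2.2 j
  have hright (j) : 0 ≤ orient (vertexFrom P i m) t (P j) := by
    rw [orient_swap]
    simpa [Direction.sign, vertexFrom] using mul_orient_vertex_nonneg hO hq.2.2 j
  rcases Nat.eq_zero_or_pos k with rfl | hk0
  · rwa [vertexFrom_zero]
  rcases hk.eq_or_lt with rfl | hkm
  · exact hlast
  have hbehind := hP.orient_vertexFrom_pos i hk0 hkm (by omega)
  rw [orient_swap_right, vertexFrom_zero, neg_pos] at hbehind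
  refine orient_neg_of_behind_chord hfirst hlast (hleft _) ?_ (hleft _) (hright _) hbehind
  rw [orient_rotate]
  exact hright i

lemma orient_detourPoint_pos (hP : IsConvexPolygon P) (ho : o ∈ obstacle P)
    (hi : IsTangentVertex P .ccw s i) (hq : IsTangentVertex P .cw t (i + Fin.ofNat n m)) {k : ℕ}
    (hk : k ≤ m + 1) :
    0 < orient (detourPoint P s t i m k) (detourPoint P s t i m (k + 1)) o := by
  rcases k with _ | k
  · rw [detourPoint_succ m.zero_le, vertexFrom_zero]
    simpa [Direction.sign, detourPoint] using hi.orient_pos ho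
  rcases (Nat.le_of_succ_le_succ hk).lt_or_eq with hkm | rfl
  · rw [detourPoint_succ hkm.le, detourPoint_succ hkm, vertexFrom_succ]
    exact hP.orient_edge_pos _ ho
  · rw [detourPoint_succ le_rfl, detourPoint_last, orient_swap]
    simpa [Direction.sign, vertexFrom] using hq.orient_pos ho

lemma orient_source_vertexFrom_one_pos (hP : IsConvexPolygon P) (ho : o ∈ obstacle P)
    (hi : IsFurthestSeenVertex P .ccw s i) : 0 < orient s (P i) (vertexFrom P i 1) := by
  have hedge := hP.orient_edge_pos i ho
  have := hi.orient_pos (j := i + 1) ⟨o, ho⟩ ho (by simpa [Direction.sign] using hedge)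
  simpa [Direction.sign, vertexFrom_succ] using this

lemma orient_vertexFrom_succ_target_pos (hP : IsConvexPolygon P) (ho : o ∈ obstacle P)
    (hq : IsFurthestSeenVertex P .cw t (i + Fin.ofNat n (m + 1))) :
    0 < orient (vertexFrom P i m) (vertexFrom P i (m + 1)) t := by
  have hedge := hP.orient_edge_pos (i + Fin.ofNat n m) ho
  rw [← vertexFrom_succ, orient_swap] at hedge
  have := hq.orient_pos (j := i + Fin.ofNat n m) ⟨o, ho⟩ ho (by
    simpa [Direction.sign, vertexFrom] using hedge)
  rw [orient_swap_right] at this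
  rw [← orient_rotate]
  simpa [Direction.sign, vertexFrom] using this

lemma orient_detourPoint_succ_pos (hP : IsConvexPolygon P) (hseg : o ∈ openSegment ℝ s t)
    (ho : o ∈ obstacle P) (hi : IsFurthestSeenVertex P .ccw s i)
    (hq : IsFurthestSeenVertex P .cw t (i + Fin.ofNat n m)) {k : ℕ} (hk : k < m + 1) :
    0 < orient (detourPoint P s t i m k) (detourPoint P s t i m (k + 1))
      (detourPoint P s t i m (k + 2)) := by
  rcases k with _ | k
  · rw [detourPoint_succ m.zero_le, vertexFrom_zero]
    rcases Nat.eq_zero_or_pos m with rfl | hm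
    · rw [detourPoint_last, orient_swap_right, neg_pos]
      simpa [Direction.sign, detourPoint] using hi.1.orient_chord_neg hseg ho
    · rw [detourPoint_succ hm]
      exact orient_source_vertexFrom_one_pos hP ho hi
  rw [detourPoint_succ (by omega), detourPoint_succ (by omega)]
  rcases (Nat.le_of_lt_succ hk).eq_or_lt with rfl | hkm
  · rw [detourPoint_last]
    exact orient_vertexFrom_succ_target_pos hP ho hq
  · rw [detourPoint_succ hkm]
    exact hP.orient_vertexFrom_succ_pos i (by omega) (by have := hP.1; omega)

lemma isTautChain_detourPoint (hP : IsConvexPolygon P) (hseg : o ∈ openSegment ℝ s t)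
    (ho : o ∈ obstacle P) (hi : IsFurthestSeenVertex P .ccw s i)
    (hq : IsFurthestSeenVertex P .cw t (i + Fin.ofNat n m)) (hmn : m < n) :
    IsTautChain (obstacle P) o s t (detourPoint P s t i m) (m + 1) where
  mem_openSegment := hseg
  start := rfl
  finish := detourPoint_last
  left _ hk := orient_detourPoint_pos hP ho hi.1 hq.1 hk
  turn _ hk := orient_detourPoint_succ_pos hP hseg ho hi hq hk
  side k hk := by
    rw [detourPoint_succ (Nat.le_of_lt_succ hk)]
    exact orient_vertexFrom_neg hP hseg ho hi.1 hq.1 hmn (Nat.le_of_lt_succ hk)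
  star k hk c hc0 hc1 := by
    rw [detourPoint_succ (Nat.le_of_lt_succ hk)]
    exact lineMap_mem_of_mem_closure convex_obstacle isOpen_obstacle ho
      (vertex_mem_closure_obstacle ⟨o, ho⟩ _) hc0 hc1

end DetourChain

section OptimalDetour

lemma IsTautChain.segment_subset_sideHalfPlane {O : Set Plane} {o s t : Plane} {W : ℕ → Plane}
    {m : ℕ} (hW : IsTautChain O o s t W m) {k : ℕ} (hk : k < m + 1) :
    segment ℝ (W k) (W (k + 1)) ⊆ sideHalfPlane .ccw s t := by
  have hmem : ∀ k ≤ m + 1, W k ∈ {x | 0 ≤ (-1) * orient s t x} := by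
    intro k hk
    rcases k with _ | k
    · simp [hW.start]
    rcases hk.eq_or_lt with hkm | hkm
    · simp [Nat.succ_injective hkm, hW.finish]
    · have := hW.side k (Nat.lt_of_succ_lt_succ hkm)
      simp only [mem_ofPred_eq]
      linarith
  refine ((convex_setOf_mul_orient_nonneg (-1) s t).segment_subset (hmem k hk.le)
    (hmem (k + 1) hk)).trans fun x hx => ?_
  simpa [sideHalfPlane, Direction.sign] using hx

variable {n : ℕ} {P : Polygon Plane n} {d : Direction} {s t o : Plane}

lemma symm_mem_legalPaths {γ : Path s t} (h : γ ∈ legalPaths P s t) : γ.symm ∈ legalPaths P t s :=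
  (Path.symm_range γ).trans_subset h

variable [NeZero n] {i q : Fin n}

/-- The detour is the image of a legal polygonal path on its side of the line through `s` and `t`,
and this path is the only shortest one, up to its parametrization, among the legal paths that pass
`o` on this side. -/
structure IsOptimalDetour (P : Polygon Plane n) (d : Direction) (s t o : Plane) (i q : Fin n) :
    Prop where
  exists_path : ∃ β ∈ legalPathsWithin P (sideHalfPlane d s t) s t, IsPolygonalPath β ∧
    range β = detour P d s t i q ∧ pathLength β = ENNReal.ofReal (detourLength P d s t i q)
  le_pathLength : ∀ γ ∈ legalPaths P s t, PassesOn d o γ →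
    ENNReal.ofReal (detourLength P d s t i q) ≤ pathLength γ
  range_eq : ∀ γ ∈ legalPaths P s t, PassesOn d o γ →
    pathLength γ ≤ ENNReal.ofReal (detourLength P d s t i q) → range γ = detour P d s t i q

lemma isOptimalDetour_ccw (hP : IsConvexPolygon P) (hseg : o ∈ openSegment ℝ s t)
    (ho : o ∈ obstacle P) (hi : IsFurthestSeenVertex P .ccw s i)
    (hq : IsFurthestSeenVertex P .cw t q) : IsOptimalDetour P .ccw s t o i q := by
  have hW := isTautChain_detourPoint hP hseg ho hi (m := (q - i).val)
    (by rwa [add_ofNat_val_sub]) (q - i).isLt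
  have hrange := detour_ccw_eq_iUnion P s t i q
  have hlength := detourLength_ccw_eq_sum P s t i q
  constructor
  · obtain ⟨β, hpoly, himage, hβ⟩ := exists_isPolygonalPath
      (detourPoint P s t i (q - i).val) ((q - i).val + 1)
    rw [← hrange] at himage
    rw [← hlength] at hβ
    refine ⟨β.cast rfl hW.finish.symm, ⟨?_, ?_⟩, hpoly, himage, hβ⟩
    · exact himage.trans_subset (hP.detour_subset_freeSpace .ccw hi.1.2.1 hq.1.2.1)
    · exact (himage.trans hrange).trans_subset
        (iUnion₂_subset fun k hk => hW.segment_subset_sideHalfPlane hk)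
  · intro γ hγ hpass
    rw [hlength]
    exact hW.le_pathLength (fun u => hγ (mem_range_self u)) hpass
  · intro γ hγ hpass hle
    rw [hlength] at hle
    rw [hrange]
    exact hW.range_eq_of_pathLength_le (fun u => hγ (mem_range_self u)) hpass hle

lemma detour_symm (P : Polygon Plane n) (d : Direction) (s t : Plane) (i q : Fin n) :
    detour P d.reverse t s q i = detour P d s t i q := by
  unfold detour
  rw [segment_symm ℝ t, segment_symm ℝ (P i), union_comm, ← union_assoc, union_right_comm,
    union_assoc, ← union_assoc]
  cases d <;> rfl

lemma detourLength_symm (P : Polygon Plane n) (d : Direction) (s t : Plane) (i q : Fin n) :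
    detourLength P d.reverse t s q i = detourLength P d s t i q := by
  have hchain : boundaryChainLength P d.reverse q i = boundaryChainLength P d i q := by
    cases d <;> rfl
  rw [detourLength, detourLength, hchain, dist_comm t, dist_comm (P i)]
  ring

lemma pathLength_symm {a b : Plane} (γ : Path a b) : pathLength γ.symm = pathLength γ :=
  eVariationOn_symm γ

lemma IsOptimalDetour.symm (h : IsOptimalDetour P d s t o i q) :
    IsOptimalDetour P d.reverse t s o q i := by
  obtain ⟨⟨β, hβ, hpoly, hrange, hlength⟩, hle, heq⟩ := h
  have hpass (γ : Path t s) (h : PassesOn d.reverse o γ) : PassesOn d o γ.symm := by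
    cases d <;> exact h.symm
  refine ⟨⟨β.symm, ⟨symm_mem_legalPaths hβ.1, ?_⟩, hpoly.symm, ?_, ?_⟩, fun γ hγ h => ?_,
    fun γ hγ h hγle => ?_⟩
  · rw [Path.symm_range, sideHalfPlane_reverse]
    exact hβ.2
  · rw [Path.symm_range, hrange, detour_symm]
  · rw [pathLength_symm, hlength, detourLength_symm]
  · rw [detourLength_symm, ← pathLength_symm]
    exact hle _ (symm_mem_legalPaths hγ) (hpass γ h)
  · rw [detourLength_symm, ← pathLength_symm] at hγle
    rw [detour_symm, ← Path.symm_range]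
    exact heq _ (symm_mem_legalPaths hγ) (hpass γ h) hγle

lemma isOptimalDetour (hP : IsConvexPolygon P) (hseg : o ∈ openSegment ℝ s t)
    (ho : o ∈ obstacle P) (hi : IsFurthestSeenVertex P d s i)
    (hq : IsFurthestSeenVertex P d.reverse t q) : IsOptimalDetour P d s t o i q := by
  cases d with
  | ccw => exact isOptimalDetour_ccw hP hseg ho hi hq
  | cw => exact (isOptimalDetour_ccw hP (openSegment_symm ℝ s t ▸ hseg) ho hq hi).symm

namespace IsOptimalDetour

lemma exists_isShortestIn (h : IsOptimalDetour P d s t o i q) :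
    ∃ β : Path s t, IsPolygonalPath β ∧ range β = detour P d s t i q ∧
      pathLength β = ENNReal.ofReal (detourLength P d s t i q) ∧
      IsShortestIn (legalPathsWithin P (sideHalfPlane d s t) s t) β := by
  obtain ⟨β, hβ, hpoly, hrange, hlength⟩ := h.exists_path
  refine ⟨β, hpoly, hrange, hlength, hβ, fun γ hγ => hlength ▸ ?_⟩
  exact h.le_pathLength γ hγ.1 (passesOn_of_range_subset hγ.2 o)

lemma range_eq_of_isShortestIn (h : IsOptimalDetour P d s t o i q) {γ : Path s t}
    (hγ : IsShortestIn (legalPathsWithin P (sideHalfPlane d s t) s t) γ) :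
    range γ = detour P d s t i q := by
  obtain ⟨β, hβ, -, -, hlength⟩ := h.exists_path
  exact h.range_eq γ hγ.1.1 (passesOn_of_range_subset hγ.1.2 o) (hlength ▸ hγ.2 β hβ)

variable {i q : Direction → Fin n} (h : ∀ d, IsOptimalDetour P d s t o (i d) (q d))

include h

lemma exists_isPolygonalPath_isShortestIn (ho : o ∈ segment ℝ s t) :
    ∃ β : Path s t, IsPolygonalPath β ∧ IsShortestIn (legalPaths P s t) β := by
  obtain ⟨d₀, hd₀⟩ : ∃ d₀ : Direction, ∀ d, detourLength P d₀ s t (i d₀) (q d₀) ≤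
      detourLength P d s t (i d) (q d) := by
    rcases le_total (detourLength P .ccw s t (i .ccw) (q .ccw))
      (detourLength P .cw s t (i .cw) (q .cw)) with hle | hle
    · exact ⟨.ccw, Direction.rec le_rfl hle⟩
    · exact ⟨.cw, Direction.rec hle le_rfl⟩
  obtain ⟨β, hβ, hpoly, -, hlength⟩ := (h d₀).exists_path
  refine ⟨β, hpoly, hβ.1, fun γ hγ => ?_⟩
  obtain ⟨d, hd⟩ := exists_passesOn ho γ
  calc pathLength β = ENNReal.ofReal (detourLength P d₀ s t (i d₀) (q d₀)) := hlength
    _ ≤ ENNReal.ofReal (detourLength P d s t (i d) (q d)) := ENNReal.ofReal_le_ofReal (hd₀ d)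
    _ ≤ pathLength γ := (h d).le_pathLength γ hγ hd

lemma exists_range_eq_pathLength_eq (ho : o ∈ segment ℝ s t) {γ : Path s t}
    (hγ : IsShortestIn (legalPaths P s t) γ) :
    ∃ d, range γ = detour P d s t (i d) (q d) ∧
      pathLength γ = ENNReal.ofReal (detourLength P d s t (i d) (q d)) := by
  obtain ⟨d, hd⟩ := exists_passesOn ho γ
  obtain ⟨β, hβ, -, -, hlength⟩ := (h d).exists_path
  have hle := (hγ.2 β hβ.1).trans_eq hlength
  exact ⟨d, (h d).range_eq γ hγ.1 hd hle, hle.antisymm ((h d).le_pathLength γ hγ.1 hd)⟩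

end IsOptimalDetour

end OptimalDetour

end ConvexObstacle

theorem mainTheorem5 {n : ℕ} [NeZero n] (P : Polygon Plane n) (hP : IsConvexPolygon P)
    (s t : Plane) (hs : s ∈ freeSpace P) (ht : t ∈ freeSpace P) (hst : ¬ Visible P s t) :
    -- the vertices `v_i`, `v_q` exist and are unique, for each of the two directions
    (∀ d : Direction, ∃! k : Fin n, IsFurthestSeenVertex P d s k) ∧
    (∀ d : Direction, ∃! k : Fin n, IsFurthestSeenVertex P d.reverse t k) ∧
    ∀ i q : Direction → Fin n,
      (∀ d, IsFurthestSeenVertex P d s (i d)) →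
      (∀ d, IsFurthestSeenVertex P d.reverse t (q d)) →
      -- for each direction, `B` is a polygonal path, and it is the shortest one among all the
      -- legal paths in the supporting half plane
      (∀ d : Direction,
        (∃ β : Path s t, IsPolygonalPath β ∧ range β = detour P d s t (i d) (q d) ∧
          pathLength β = ENNReal.ofReal (detourLength P d s t (i d) (q d)) ∧
          IsShortestIn (legalPathsWithin P (sideHalfPlane d s t) s t) β) ∧
        (∀ γ : Path s t, IsShortestIn (legalPathsWithin P (sideHalfPlane d s t) s t) γ →
          range γ = detour P d s t (i d) (q d))) ∧
      -- shortest legal polygonal paths exist, are of the form `B` for one of the two directions,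
      -- and are shortest among all legal paths
      (∃ γ : Path s t, IsShortestIn (legalPolygonalPaths P s t) γ) ∧
      (∀ γ : Path s t, IsShortestIn (legalPolygonalPaths P s t) γ →
        (∃ d : Direction, range γ = detour P d s t (i d) (q d) ∧
          pathLength γ = ENNReal.ofReal (detourLength P d s t (i d) (q d))) ∧
        IsShortestIn (legalPaths P s t) γ) := by
  obtain ⟨o, hseg, ho⟩ := exists_mem_openSegment_obstacle hs ht hst
  have hO : (obstacle P).Nonempty := ⟨o, ho⟩
  refine ⟨hP.existsUnique_isFurthestSeenVertex hO hs,
    fun d => hP.existsUnique_isFurthestSeenVertex hO ht d.reverse, fun i q hi hq => ?_⟩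
  have hopt (d) : IsOptimalDetour P d s t o (i d) (q d) := isOptimalDetour hP hseg ho (hi d) (hq d)
  have hseg' := openSegment_subset_segment ℝ s t hseg
  obtain ⟨β, hpoly, hβ⟩ := IsOptimalDetour.exists_isPolygonalPath_isShortestIn hopt hseg'
  refine ⟨fun d => ⟨(hopt d).exists_isShortestIn, fun γ => (hopt d).range_eq_of_isShortestIn⟩,
    ⟨β, ⟨hβ.1, hpoly⟩, fun γ hγ => hβ.2 γ hγ.1⟩, fun γ hγ => ?_⟩
  have hshortest : IsShortestIn (legalPaths P s t) γ :=
    ⟨hγ.1.1, fun γ' hγ' => (hγ.2 β ⟨hβ.1, hpoly⟩).trans (hβ.2 γ' hγ')⟩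
  exact ⟨IsOptimalDetour.exists_range_eq_pathLength_eq hopt hseg' hshortest, hshortest⟩
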